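/- Let $\Sigma=\Gamma\backslash\mathbb H^2$ be a closed oriented hyperbolic surface (so of genus $g\ge 2$), where $\Gamma$ is its group of deck transformations acting on the universal cover $\mathbb H^2$. Let $\Delta$ be a one-vertex triangulation of $\Sigma$: finitely many triangles glued along their sides so that all corners become one vertex, the open cells being embedded and partitioning $\Sigma$; thus every edge is a simple closed curve through the vertex. Suppose that $\Delta$ is essential, i.e. no edge loop is null-homotopic. A *wall* is a connected component $w$ of the preimage in $\mathbb H^2$ of an edge of $\Delta$; the connected components of $\mathbb H^2\setminus w$ are its half-spaces. An intersection of a path $L$ with a wall $w$ at time $t$ is *transverse* if $L$ runs in one half-space of $w$ just before $t$ and in a different half-space of $w$ just after $t$ (at the initial time of a ray there is no condition on earlier times). A ray $L:[0,\infty)\to\mathbb H^2$ has *endpoint* $\xi$ in the circle at infinity $S^1$ if $L(t)\to\xi$ as $t\to\infty$ in the compactification of $\mathbb H^2$ (in the Poincaré disk model) by the closed unit disk. 1. Let $L:[0,\infty)\to\mathbb H^2$ be an embedded path which meets each wall for at most one value of the parameter, and transversely whenever it meets it. If $L$ meets infinitely many walls, then $L$ has a unique endpoint in the circle at infinity. 2.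 Let $L:(-\infty,\infty)\to\mathbb H^2$ be a continuous path which meets each wall for at most one value of the parameter, and transversely whenever it meets it. If both rays $t\mapsto L(t)$ and $t\mapsto L(-t)$, $t\ge 0$, meet infinitely many walls, then both rays have endpoints in the circle at infinity, and these two endpoints are distinct. -/

import Mathlib

open Filter Topology UpperHalfPlane
open scoped MatrixGroups unitInterval NNReal

namespace FLOiation

/-! ### Closed hyperbolic surfaces -/

/-- `Γ ≤ SL(2, ℝ)` is (the full preimage of, or a lift of) the deck group of a closed oriented
hyperbolic surface: it is discrete, it acts freely on the hyperbolic plane up to elements acting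
trivially (such as `-1`), and the quotient is compact. -/
structure IsClosedSurfaceGroup (Γ : Subgroup SL(2, ℝ)) : Prop where
  discrete : DiscreteTopology Γ
  free : ∀ g ∈ Γ, (∃ z : ℍ, g • z = z) → ∀ z : ℍ, g • z = z
  compact : CompactSpace (MulAction.orbitRel.Quotient Γ ℍ)

/-- The surface `Γ \ ℍ` with its quotient topology. -/
abbrev Surface (Γ : Subgroup SL(2, ℝ)) : Type := MulAction.orbitRel.Quotient Γ ℍ

/-- The covering projection `ℍ → Γ \ ℍ`. -/
noncomputable def proj (Γ : Subgroup SL(2, ℝ)) (z : ℍ) : Surface Γ := Quotient.mk _ z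

/-! ### One-vertex triangulations -/

/-- The point at time `s` on the side opposite to the vertex `i` of the standard triangle; this
side runs from the vertex `i + 1` to the vertex `i + 2` (indices modulo 3). -/
def sidePoint (i : Fin 3) (s : I) : stdSimplex ℝ (Fin 3) :=
  ⟨fun j => if j = i then 0 else if j = i + 1 then 1 - (s : ℝ) else s, by
    constructor
    · intro j
      dsimp only
      split_ifs
      · exact le_rfl
      · linarith [s.2.2]
      · exact s.2.1
    · fin_cases i <;> simp [Fin.sum_univ_three]⟩

/-- The interior of the standard triangle. -/
def openTriangle : Set (stdSimplex ℝ (Fin 3)) := {x | ∀ i, 0 < x.1 i}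

/-- The open cells of a family of characteristic maps: the vertex, the open edges and the open
triangles. -/
def openCell {X E T : Type} (v : X) (e : E → I → X) (τ : T → stdSimplex ℝ (Fin 3) → X) :
    Unit ⊕ E ⊕ T → Set X
  | .inl _ => {v}
  | .inr (.inl a) => e a '' Set.Ioo 0 1
  | .inr (.inr t) => τ t '' openTriangle

/-- A (finite) one-vertex triangulation of a space `X`: finitely many triangles glued along their
sides so that all their corners become a single vertex, given by characteristic maps. Sides of one
triangle may be glued to each other, and the edges are loops at the vertex. -/
structure OneVertexTriangulation (X : Type) [TopologicalSpace X] where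
  Edge : Type
  Triangle : Type
  finite_edge : Finite Edge
  finite_triangle : Finite Triangle
  vertex : X
  edge : Edge → Path vertex vertex
  triangle : Triangle → C(stdSimplex ℝ (Fin 3), X)
  /-- The characteristic map of an edge is injective on the open edge. -/
  edge_injOn : ∀ a, Set.InjOn (edge a) (Set.Ioo 0 1)
  /-- The characteristic map of a triangle is injective on the open triangle. -/
  triangle_injOn : ∀ t, Set.InjOn (triangle t) openTriangle
  /-- `X` is the disjoint union of the open cells. -/
  partition : ∀ x : X, ∃! c, x ∈ openCell vertex (fun a => edge a) (fun t => triangle t) c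
  /-- Each side of each triangle is an edge, traversed in one of the two directions. -/
  side : ∀ t i, ∃ a, (∀ s, triangle t (sidePoint i s) = edge a s) ∨
    (∀ s, triangle t (sidePoint i s) = edge a (unitInterval.symm s))

/-- A one-vertex triangulation is essential if no edge loop is null-homotopic. -/
def OneVertexTriangulation.IsEssential {X : Type} [TopologicalSpace X]
    (Δ : OneVertexTriangulation X) : Prop :=
  ∀ a, ¬ (Δ.edge a).Homotopic (Path.refl Δ.vertex)

/-! ### Walls, half-spaces and transversality -/

/-- A wall is a connected component of the preimage in `ℍ` of a (closed) edge. -/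
def IsWall {Γ : Subgroup SL(2, ℝ)} (Δ : OneVertexTriangulation (Surface Γ)) (W : Set ℍ) : Prop :=
  ∃ a, ∃ z ∈ proj Γ ⁻¹' Set.range (Δ.edge a),
    W = connectedComponentIn (proj Γ ⁻¹' Set.range (Δ.edge a)) z

/-- The half-spaces of `W` are the connected components of its complement. -/
def IsHalfSpace (W H : Set ℍ) : Prop := ∃ z ∈ Wᶜ, H = connectedComponentIn Wᶜ z

/-- The path `L` is transverse to `W` at time `t`: just before `t` it runs in one half-space of
`W`, and just after `t` in a different one. (If `t` is the initial time of `L`, the condition on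
the times before `t` is void.) -/
def IsTransverseAt {T : Type} [TopologicalSpace T] [Preorder T] (L : T → ℍ) (W : Set ℍ) (t : T) :
    Prop :=
  ∃ H₁ H₂, IsHalfSpace W H₁ ∧ IsHalfSpace W H₂ ∧ H₁ ≠ H₂ ∧
    (∀ᶠ s in 𝓝[<] t, L s ∈ H₁) ∧ (∀ᶠ s in 𝓝[>] t, L s ∈ H₂)

/-- The path `L` meets each wall at most once, and each time transversely. -/
def MeetsWallsTransversely {Γ : Subgroup SL(2, ℝ)} (Δ : OneVertexTriangulation (Surface Γ))
    {T : Type} [TopologicalSpace T] [Preorder T] (L : T → ℍ) : Prop :=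
  ∀ W, IsWall Δ W → {t | L t ∈ W}.Subsingleton ∧ ∀ t, L t ∈ W → IsTransverseAt L W t

/-- The path `L` meets infinitely many walls. -/
def MeetsInfinitelyManyWalls {Γ : Subgroup SL(2, ℝ)} (Δ : OneVertexTriangulation (Surface Γ))
    {T : Type} (L : T → ℍ) : Prop :=
  {W | IsWall Δ W ∧ ∃ t, L t ∈ W}.Infinite

/-! ### The circle at infinity -/

/-- The Cayley transform, an isometry from `ℍ` onto the Poincaré disk. -/
noncomputable def toDisk (z : ℍ) : ℂ := ((z : ℂ) - Complex.I) / ((z : ℂ) + Complex.I)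

/-- The ray `L` has the endpoint `ξ` on the circle at infinity: in the compactification of the
hyperbolic plane by the closed unit disk, `L t` converges to `ξ` as `t → ∞`. -/
def HasEndpoint (L : ℝ≥0 → ℍ) (ξ : Circle) : Prop :=
  Tendsto (fun t => toDisk (L t)) atTop (𝓝 (ξ : ℂ))

end FLOiation

namespace FLOiation

open scoped ComplexConjugate Pointwise

/-! ### The disk model -/

/-! A wall behaves like a geodesic. Lift an edge to an arc in `ℍ`: a deck transformation `g` carries
its start to its end, and `g` is nontrivial because the edge is essential. Compactness of the
quotient makes `g` hyperbolic, so the wall, a translate of the union of the arcs `g ^ n • K`, stays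
at bounded distance from an axis (`exists_wall_structure`, `IsAxial`). In the disk such sets are
locally finite, and all but finitely many have diameter at most any given `ε > 0`
(`exists_wall_family`); hence all but finitely many lie in small caps at the circle
(`finite_not_in_cap`).

For existence of endpoints, a ray that crosses a wall contained in a cap avoiding its starting point
can never leave the cap again: the rest of the disk is convex, hence connected, and misses the wall.
Crossing infinitely many walls therefore traps the ray in ever smaller caps, and it converges to a
point of the circle (`exists_hasEndpoint`).

For distinctness, suppose that both rays converge to `ξ`. Every wall crossed separates points
arbitrarily close to `ξ`, so it accumulates at `ξ`, and its axis ends there. But only finitely many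
walls share an end (`finite_common_end`): a translation `g₀` along one of the axes pulls all of them
back to a fixed compact set. Local finiteness then makes a power of `g₀` preserve each wall, so each
wall itself meets this compact set. -/

lemma add_I_ne_zero (z : ℍ) : (z : ℂ) + Complex.I ≠ 0 := by
  intro h
  have := congrArg Complex.im h
  simp at this
  linarith [z.im_pos]

lemma one_sub_normSq_toDisk (z : ℍ) :
    1 - Complex.normSq (toDisk z) = 4 * z.im / Complex.normSq ((z : ℂ) + Complex.I) := by
  have h0 : Complex.normSq ((z : ℂ) + Complex.I) ≠ 0 := by
    simpa [Complex.normSq_eq_zero] using add_I_ne_zero z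
  rw [toDisk, Complex.normSq_div, eq_div_iff h0, sub_mul, div_mul_cancel₀ _ h0]
  simp [Complex.normSq_apply]
  ring

lemma norm_toDisk_lt_one (z : ℍ) : ‖toDisk z‖ < 1 := by
  have h0 : 0 < Complex.normSq ((z : ℂ) + Complex.I) :=
    Complex.normSq_pos.2 (add_I_ne_zero z)
  have := one_sub_normSq_toDisk z
  have h2 : 0 < 4 * z.im / Complex.normSq ((z : ℂ) + Complex.I) :=
    div_pos (by linarith [z.im_pos]) h0
  rw [Complex.normSq_eq_norm_sq] at this
  nlinarith [norm_nonneg (toDisk z)]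

lemma continuous_toDisk : Continuous toDisk := by
  unfold toDisk
  exact (continuous_coe.sub continuous_const).div (continuous_coe.add continuous_const)
    add_I_ne_zero

/-- The inverse of the Cayley transform. -/
noncomputable def ofDisk (w : ℂ) : ℂ := Complex.I * (1 + w) / (1 - w)

lemma one_sub_ne_zero_of_norm_lt {w : ℂ} (hw : ‖w‖ < 1) : 1 - w ≠ 0 := by
  intro h
  rw [← sub_eq_zero.1 h] at hw
  simp at hw

lemma ofDisk_im_pos {w : ℂ} (hw : ‖w‖ < 1) : 0 < (ofDisk w).im := by
  have h0 := one_sub_ne_zero_of_norm_lt hw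
  have h1 : 0 < Complex.normSq (1 - w) := Complex.normSq_pos.2 h0
  have h2 : (ofDisk w).im = (1 - Complex.normSq w) / Complex.normSq (1 - w) := by
    rw [ofDisk, Complex.div_im]
    field_simp
    simp [Complex.normSq_apply]
    ring
  rw [h2]
  apply div_pos _ h1
  rw [Complex.normSq_eq_norm_sq]
  nlinarith [norm_nonneg w]

lemma toDisk_ofDisk {w : ℂ} (hw : ‖w‖ < 1) : toDisk ⟨ofDisk w, ofDisk_im_pos hw⟩ = w := by
  have h0 := one_sub_ne_zero_of_norm_lt hw
  have h1 := add_I_ne_zero ⟨ofDisk w, ofDisk_im_pos hw⟩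
  rw [toDisk, div_eq_iff h1]
  simp only [ofDisk]
  field_simp
  ring

lemma ofDisk_toDisk (z : ℍ) : ofDisk (toDisk z) = z := by
  have h1 := add_I_ne_zero z
  have h0 := one_sub_ne_zero_of_norm_lt (norm_toDisk_lt_one z)
  rw [ofDisk, div_eq_iff h0]
  simp only [toDisk]
  field_simp
  ring

/-- A convex part of the disk is connected, seen in the upper half-plane. -/
lemma isPreconnected_preimage_toDisk {C : Set ℂ} (hC : Convex ℝ C) :
    IsPreconnected (toDisk ⁻¹' C) := by
  have hconv : IsPreconnected (C ∩ Metric.ball 0 1) :=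
    (hC.inter (convex_ball 0 1)).isPreconnected
  have himg : ((↑) : ℍ → ℂ) '' (toDisk ⁻¹' C) = ofDisk '' (C ∩ Metric.ball 0 1) := by
    ext w
    constructor
    · rintro ⟨z, hz, rfl⟩
      exact ⟨toDisk z, ⟨hz, by simpa using norm_toDisk_lt_one z⟩, ofDisk_toDisk z⟩
    · rintro ⟨u, ⟨hu, hu1⟩, rfl⟩
      have hu1 : ‖u‖ < 1 := by simpa using hu1
      exact ⟨⟨ofDisk u, ofDisk_im_pos hu1⟩, by simpa [toDisk_ofDisk hu1] using hu, rfl⟩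
  rw [← isEmbedding_coe.isInducing.isPreconnected_image, himg]
  apply hconv.image
  intro w hw
  have hw1 : ‖w‖ < 1 := by simpa using hw.2
  have h0 := one_sub_ne_zero_of_norm_lt hw1
  apply ContinuousAt.continuousWithinAt
  unfold ofDisk
  exact ContinuousAt.div (by fun_prop) (by fun_prop) h0

lemma isCompact_toDisk_preimage_closedBall {s : ℝ} (hs : s < 1) :
    IsCompact (toDisk ⁻¹' Metric.closedBall 0 s) := by
  rw [isEmbedding_coe.isInducing.isCompact_iff]
  have himg : ((↑) : ℍ → ℂ) '' (toDisk ⁻¹' Metric.closedBall 0 s)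
      = ofDisk '' (Metric.closedBall 0 s) := by
    ext w
    constructor
    · rintro ⟨z, hz, rfl⟩
      exact ⟨toDisk z, hz, ofDisk_toDisk z⟩
    · rintro ⟨u, hu, rfl⟩
      have hu1 : ‖u‖ < 1 := by
        have : ‖u‖ ≤ s := by simpa using hu
        linarith
      exact ⟨⟨ofDisk u, ofDisk_im_pos hu1⟩, by simpa [toDisk_ofDisk hu1] using hu, rfl⟩
  rw [himg]
  apply (isCompact_closedBall 0 s).image_of_continuousOn
  intro w hw
  have hw1 : ‖w‖ < 1 := by
    have : ‖w‖ ≤ s := by simpa using hw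
    linarith
  have h0 := one_sub_ne_zero_of_norm_lt hw1
  apply ContinuousAt.continuousWithinAt
  unfold ofDisk
  exact ContinuousAt.div (by fun_prop) (by fun_prop) h0

/-! ### Neighbourhoods of geodesics and their images in the disk -/

/-- The Euclidean cone of points at bounded hyperbolic distance from the imaginary axis. -/
def cone (r : ℝ) : Set ℍ := {z | ‖(z : ℂ)‖ ≤ r * z.im}

lemma cone_mono {r s : ℝ} (h : r ≤ s) : cone r ⊆ cone s := fun z hz =>
  le_trans hz (mul_le_mul_of_nonneg_right h z.im_pos.le)

/-- A truncated cone. -/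
def slab (r m M : ℝ) : Set ℍ := {z | z ∈ cone r ∧ m ≤ z.im ∧ z.im ≤ M}

lemma isCompact_slab (r M : ℝ) {m : ℝ} (hm : 0 < m) : IsCompact (slab r m M) := by
  rw [isEmbedding_coe.isInducing.isCompact_iff]
  have himg : ((↑) : ℍ → ℂ) '' (slab r m M)
      = {w : ℂ | ‖w‖ ≤ r * w.im ∧ m ≤ w.im ∧ w.im ≤ M} := by
    ext w
    constructor
    · rintro ⟨z, hz, rfl⟩
      exact hz
    · intro hw
      exact ⟨⟨w, hm.trans_le hw.2.1⟩, hw, rfl⟩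
  rw [himg]
  apply Metric.isCompact_of_isClosed_isBounded
  · have h1 : IsClosed {w : ℂ | ‖w‖ ≤ r * w.im} := isClosed_le (by fun_prop) (by fun_prop)
    have h2 : IsClosed {w : ℂ | m ≤ w.im} := isClosed_le (by fun_prop) (by fun_prop)
    have h3 : IsClosed {w : ℂ | w.im ≤ M} := isClosed_le (by fun_prop) (by fun_prop)
    exact h1.inter (h2.inter h3)
  · rw [isBounded_iff_forall_norm_le]
    refine ⟨|r| * M, fun w hw => hw.1.trans ?_⟩
    have := hw.2.1
    calc r * w.im ≤ |r| * w.im := mul_le_mul_of_nonneg_right (le_abs_self r) (by linarith)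
      _ ≤ |r| * M := mul_le_mul_of_nonneg_left hw.2.2 (abs_nonneg r)

/-- The coefficient of `z` in the denominator of `toDisk (h • z)`. -/
noncomputable def diskC (h : SL(2, ℝ)) : ℂ := h 0 0 + h 1 0 * Complex.I

/-- The constant term in the denominator of `toDisk (h • z)`. -/
noncomputable def diskD (h : SL(2, ℝ)) : ℂ := h 0 1 + h 1 1 * Complex.I

lemma det_eq_one (h : SL(2, ℝ)) : h 0 0 * h 1 1 - h 0 1 * h 1 0 = 1 := by
  have := h.det_coe
  rwa [Matrix.det_fin_two] at this

lemma coe_smul_eq (h : SL(2, ℝ)) (z : ℍ) :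
    ((h • z : ℍ) : ℂ) = (h 0 0 * z + h 0 1) / (h 1 0 * z + h 1 1) := by
  simp [coe_specialLinearGroup_apply]

lemma smul_denom_ne_zero (h : SL(2, ℝ)) (z : ℍ) : (h 1 0 : ℂ) * z + h 1 1 ≠ 0 := by
  intro h0
  have h1 := congrArg Complex.im h0
  have h2 := congrArg Complex.re h0
  have hd := det_eq_one h
  have hz := z.im_pos
  simp at h1 h2
  rcases h1 with h1 | h1
  · rw [h1] at h2 hd
    simp at h2
    rw [h2] at hd
    simp at hd
  · exact hz.ne' h1

/-- The condition `det h = 1` in terms of the coefficients; it keeps the denominator `diskC h * z +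
diskD h` away from zero and bounds it below. -/
lemma im_diskD_mul (h : SL(2, ℝ)) : (diskD h * conj (diskC h)).im = 1 := by
  have := det_eq_one h
  simp [diskC, diskD]
  linarith

lemma diskC_ne_zero (h : SL(2, ℝ)) : diskC h ≠ 0 := by
  intro h0
  have := im_diskD_mul h
  simp [h0] at this

lemma diskD_ne_zero (h : SL(2, ℝ)) : diskD h ≠ 0 := by
  intro h0
  have := im_diskD_mul h
  simp [h0] at this

lemma diskC_mul_add_ne_zero (h : SL(2, ℝ)) (z : ℍ) : diskC h * z + diskD h ≠ 0 := by
  intro h0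
  have h1 : (diskC h * z + diskD h) * conj (diskC h) = 0 := by rw [h0, zero_mul]
  have h2 := congrArg Complex.im h1
  rw [add_mul, Complex.add_im, im_diskD_mul, mul_right_comm, Complex.mul_conj,
    Complex.im_ofReal_mul] at h2
  have : 0 ≤ Complex.normSq (diskC h) * z.im := mul_nonneg (Complex.normSq_nonneg _) z.im_pos.le
  simp at h2
  linarith

lemma toDisk_smul (h : SL(2, ℝ)) (z : ℍ) :
    toDisk (h • z) = (conj (diskC h) * z + conj (diskD h)) / (diskC h * z + diskD h) := by
  have h1 := smul_denom_ne_zero h z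
  have h2 := add_I_ne_zero (h • z)
  have h3 := diskC_mul_add_ne_zero h z
  have hx := (eq_div_iff h1).1 (coe_smul_eq h z)
  rw [toDisk, div_eq_div_iff h2 h3]
  simp only [diskC, diskD, map_add, map_mul, Complex.conj_I, Complex.conj_ofReal]
  linear_combination 2 * Complex.I * hx

lemma conj_mul_sub_mul_conj (h : SL(2, ℝ)) :
    conj (diskC h) * diskD h - conj (diskD h) * diskC h = 2 * Complex.I := by
  have hd : (h 0 0 * h 1 1 - h 0 1 * h 1 0 : ℂ) = 1 := by exact_mod_cast det_eq_one h
  simp only [diskC, diskD, map_add, map_mul, Complex.conj_I, Complex.conj_ofReal]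
  linear_combination (2 * Complex.I) * hd

lemma norm_toDisk_smul_sub (h : SL(2, ℝ)) (z w : ℍ) :
    ‖toDisk (h • z) - toDisk (h • w)‖ =
      2 * ‖(z : ℂ) - w‖ / (‖diskC h * z + diskD h‖ * ‖diskC h * w + diskD h‖) := by
  have h1 := diskC_mul_add_ne_zero h z
  have h2 := diskC_mul_add_ne_zero h w
  have : toDisk (h • z) - toDisk (h • w) =
      2 * Complex.I * (z - w) / ((diskC h * z + diskD h) * (diskC h * w + diskD h)) := by
    rw [toDisk_smul, toDisk_smul, div_sub_div _ _ h1 h2]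
    congr 1
    linear_combination ((z : ℂ) - w) * conj_mul_sub_mul_conj h
  rw [this]
  simp

/-- The quotient `conj (diskC h) / diskC h` is the image of `∞` under `h` in the disk; with `diskD`
in place of `diskC` it is the image of `0`. -/
lemma norm_toDisk_smul_sub_infty (h : SL(2, ℝ)) (z : ℍ) :
    ‖toDisk (h • z) - conj (diskC h) / diskC h‖ =
      2 / (‖diskC h‖ * ‖diskC h * z + diskD h‖) := by
  have h1 := diskC_mul_add_ne_zero h z
  have h2 := diskC_ne_zero h
  have : toDisk (h • z) - conj (diskC h) / diskC h =
      -(2 * Complex.I) / (diskC h * (diskC h * z + diskD h)) := by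
    rw [toDisk_smul, div_sub_div _ _ h1 h2, mul_comm (diskC h) (diskC h * z + diskD h)]
    congr 1
    linear_combination - conj_mul_sub_mul_conj h
  rw [this]
  simp

lemma norm_toDisk_smul_sub_zero (h : SL(2, ℝ)) (z : ℍ) :
    ‖toDisk (h • z) - conj (diskD h) / diskD h‖ =
      2 * ‖(z : ℂ)‖ / (‖diskD h‖ * ‖diskC h * z + diskD h‖) := by
  have h1 := diskC_mul_add_ne_zero h z
  have h2 := diskD_ne_zero h
  have : toDisk (h • z) - conj (diskD h) / diskD h =
      (2 * Complex.I * z) / (diskD h * (diskC h * z + diskD h)) := by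
    rw [toDisk_smul, div_sub_div _ _ h1 h2, mul_comm (diskD h) (diskC h * z + diskD h)]
    congr 1
    linear_combination (z : ℂ) * conj_mul_sub_mul_conj h
  rw [this]
  simp

/-- By `im_diskD_mul`, the denominator times `conj (diskC h)` has imaginary part `‖diskC h‖ ^ 2 *
z.im + 1`, and in the cone `z.im` controls `‖z‖`. -/
lemma diskC_mul_norm_le {r : ℝ} (hr : 0 ≤ r) (h : SL(2, ℝ)) {z : ℍ} (hz : z ∈ cone r) :
    ‖diskC h‖ * ‖(z : ℂ)‖ ≤ r * ‖diskC h * z + diskD h‖ := by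
  have hC : 0 < ‖diskC h‖ := norm_pos_iff.2 (diskC_ne_zero h)
  have h1 : ((diskC h * z + diskD h) * conj (diskC h)).im = ‖diskC h‖ ^ 2 * z.im + 1 := by
    rw [add_mul, Complex.add_im, im_diskD_mul, mul_right_comm, Complex.mul_conj,
      Complex.im_ofReal_mul, Complex.normSq_eq_norm_sq]
    rfl
  have h2 : ‖diskC h‖ ^ 2 * z.im + 1 ≤ ‖diskC h * z + diskD h‖ * ‖diskC h‖ := by
    rw [← h1]
    refine (Complex.im_le_norm _).trans ?_
    simp
  have h3 : ‖diskC h‖ * z.im ≤ ‖diskC h * z + diskD h‖ := by nlinarith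
  have hz' : ‖(z : ℂ)‖ ≤ r * z.im := hz
  calc ‖diskC h‖ * ‖(z : ℂ)‖ ≤ ‖diskC h‖ * (r * z.im) := by gcongr
    _ = r * (‖diskC h‖ * z.im) := by ring
    _ ≤ _ := by gcongr

lemma norm_diskD_le {r : ℝ} (hr : 0 ≤ r) (h : SL(2, ℝ)) {z : ℍ} (hz : z ∈ cone r) :
    ‖diskD h‖ ≤ (1 + r) * ‖diskC h * z + diskD h‖ := by
  have h1 := diskC_mul_norm_le hr h hz
  have h2 : ‖diskD h‖ ≤ ‖diskC h * z + diskD h‖ + ‖diskC h * z‖ := by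
    have := norm_sub_le (diskC h * z + diskD h) (diskC h * z)
    simpa using this
  rw [norm_mul] at h2
  linarith

lemma norm_toDisk_smul_sub_le {r : ℝ} (hr : 0 ≤ r) (h : SL(2, ℝ)) {z w : ℍ} (hz : z ∈ cone r)
    (hw : w ∈ cone r) :
    ‖toDisk (h • z) - toDisk (h • w)‖ ≤ 4 * (1 + r) ^ 2 / (‖diskC h‖ * ‖diskD h‖) := by
  have hC : 0 < ‖diskC h‖ := norm_pos_iff.2 (diskC_ne_zero h)
  have hD : 0 < ‖diskD h‖ := norm_pos_iff.2 (diskD_ne_zero h)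
  have hz0 : 0 < ‖diskC h * z + diskD h‖ := norm_pos_iff.2 (diskC_mul_add_ne_zero h z)
  have hw0 : 0 < ‖diskC h * w + diskD h‖ := norm_pos_iff.2 (diskC_mul_add_ne_zero h w)
  rw [norm_toDisk_smul_sub, div_le_div_iff₀ (by positivity) (by positivity)]
  set A := ‖diskC h * z + diskD h‖
  set B := ‖diskC h * w + diskD h‖
  have key : ∀ (u : ℍ) (X Y : ℝ), 0 < X → 0 < Y → ‖diskC h‖ * ‖(u : ℂ)‖ ≤ r * X →
      ‖diskD h‖ ≤ (1 + r) * Y →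
      ‖(u : ℂ)‖ * (‖diskC h‖ * ‖diskD h‖) ≤ (1 + r) ^ 2 * (X * Y) := by
    intro u X Y hX hY h1 h2
    have h1' : ‖diskC h‖ * ‖(u : ℂ)‖ ≤ (1 + r) * X := by linarith
    calc ‖(u : ℂ)‖ * (‖diskC h‖ * ‖diskD h‖) = (‖diskC h‖ * ‖(u : ℂ)‖) * ‖diskD h‖ := by ring
      _ ≤ ((1 + r) * X) * ((1 + r) * Y) := by gcongr
      _ = _ := by ring
  have k1 := key z A B hz0 hw0 (diskC_mul_norm_le hr h hz) (norm_diskD_le hr h hw)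
  have k2 := key w B A hw0 hz0 (diskC_mul_norm_le hr h hw) (norm_diskD_le hr h hz)
  have k3 : ‖(z : ℂ) - w‖ * (‖diskC h‖ * ‖diskD h‖) ≤
      (‖(z : ℂ)‖ + ‖(w : ℂ)‖) * (‖diskC h‖ * ‖diskD h‖) := by
    gcongr
    exact norm_sub_le _ _
  nlinarith

/-- The product `‖diskC h‖ * ‖diskD h‖` measures how far `I` is from the axis `h (0, ∞)`. Together
with `norm_toDisk_smul_sub_le` this shows that neighbourhoods of distant axes are small in the disk.
-/
lemma inv_smul_I_mem_cone_iff (h : SL(2, ℝ)) (M : ℝ) :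
    h⁻¹ • UpperHalfPlane.I ∈ cone M ↔ ‖diskC h‖ * ‖diskD h‖ ≤ M := by
  have hC : 0 < ‖diskC h‖ := norm_pos_iff.2 (diskC_ne_zero h)
  have hcoe : ((h⁻¹ • UpperHalfPlane.I : ℍ) : ℂ) = - conj (diskD h) / conj (diskC h) := by
    have hc : conj (diskC h) ≠ 0 := by simpa using diskC_ne_zero h
    rw [coe_smul_eq, div_eq_div_iff (smul_denom_ne_zero _ _) hc]
    have e00 : h⁻¹ 0 0 = h 1 1 := by simp [Matrix.SpecialLinearGroup.SL2_inv_expl]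
    have e01 : h⁻¹ 0 1 = - h 0 1 := by simp [Matrix.SpecialLinearGroup.SL2_inv_expl]
    have e10 : h⁻¹ 1 0 = - h 1 0 := by simp [Matrix.SpecialLinearGroup.SL2_inv_expl]
    have e11 : h⁻¹ 1 1 = h 0 0 := by simp [Matrix.SpecialLinearGroup.SL2_inv_expl]
    rw [e00, e01, e10, e11]
    simp only [diskC, diskD, map_add, map_mul, Complex.conj_I, Complex.conj_ofReal,
      UpperHalfPlane.coe_I, Complex.ofReal_neg]
    ring
  have him : (h⁻¹ • UpperHalfPlane.I).im = 1 / ‖diskC h‖ ^ 2 := by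
    rw [← UpperHalfPlane.coe_im, hcoe]
    have : - conj (diskD h) / conj (diskC h) =
        (((1 / ‖diskC h‖ ^ 2 : ℝ) : ℂ)) * (- conj (diskD h * conj (diskC h))) := by
      have hn : ((‖diskC h‖ : ℂ)) ^ 2 = conj (diskC h) * diskC h := by
        rw [mul_comm, Complex.mul_conj, Complex.normSq_eq_norm_sq]; push_cast; rfl
      have hc : conj (diskC h) ≠ 0 := by simpa using diskC_ne_zero h
      have hc' := diskC_ne_zero h
      push_cast
      rw [hn]
      simp only [map_mul, Complex.conj_conj]
      field_simp
    rw [this, Complex.im_ofReal_mul]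
    simp [-map_mul, -Complex.mul_im, im_diskD_mul]
  change ‖((h⁻¹ • UpperHalfPlane.I : ℍ) : ℂ)‖ ≤ M * (h⁻¹ • UpperHalfPlane.I).im ↔ _
  rw [him, hcoe]
  simp only [norm_div, norm_neg, RCLike.norm_conj]
  rw [mul_one_div, div_le_div_iff₀ hC (by positivity)]
  constructor
  · intro h
    nlinarith
  · intro h
    nlinarith

/-- The ends of the image of a cone in the disk are the images of `∞` and of `0`. -/
lemma eq_or_eq_of_mem_closure_cone {r : ℝ} (hr : 0 < r) (h : SL(2, ℝ)) {ξ : ℂ} (hξ : ‖ξ‖ = 1)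
    (hcl : ξ ∈ closure ((fun z : ℍ => toDisk (h • z)) '' cone r)) :
    ξ = conj (diskC h) / diskC h ∨ ξ = conj (diskD h) / diskD h := by
  by_contra! hne
  obtain ⟨h1, h2⟩ := hne
  have hC : 0 < ‖diskC h‖ := norm_pos_iff.2 (diskC_ne_zero h)
  have hD : 0 < ‖diskD h‖ := norm_pos_iff.2 (diskD_ne_zero h)
  have e1 : 0 < dist ξ (conj (diskC h) / diskC h) := dist_pos.2 h1
  have e2 : 0 < dist ξ (conj (diskD h) / diskD h) := dist_pos.2 h2
  set ε₁ := dist ξ (conj (diskC h) / diskC h)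
  set ε₂ := dist ξ (conj (diskD h) / diskD h)
  -- Above height `M` the image is within `ε₁ / 2` of the image of `∞`, below height `m` within `ε₂
  -- / 2` of that of `0`. The slab in between is compact, so its image is closed and stays inside
  -- the open disk.
  set M : ℝ := 4 * r / (‖diskC h‖ ^ 2 * ε₁) with hM
  set m : ℝ := ‖diskD h‖ ^ 2 * ε₂ / (4 * (1 + r) * r) with hm
  have hM0 : 0 < M := by positivity
  have hm0 : 0 < m := by positivity
  have hsub : cone r ⊆ ({z ∈ cone r | M ≤ z.im} ∪ {z ∈ cone r | z.im ≤ m}) ∪ slab r m M := by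
    intro z hz
    rcases le_total M z.im with h | h
    · exact Or.inl (Or.inl ⟨hz, h⟩)
    rcases le_total z.im m with h' | h'
    · exact Or.inl (Or.inr ⟨hz, h'⟩)
    · exact Or.inr ⟨hz, h', h⟩
  have hcl' := closure_mono (Set.image_mono (f := fun z : ℍ => toDisk (h • z)) hsub) hcl
  rw [Set.image_union, Set.image_union, closure_union, closure_union] at hcl'
  rcases hcl' with (hcl' | hcl') | hcl'
  · have : closure ((fun z : ℍ => toDisk (h • z)) '' {z ∈ cone r | M ≤ z.im}) ⊆
        Metric.closedBall (conj (diskC h) / diskC h) (ε₁ / 2) := by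
      apply closure_minimal _ Metric.isClosed_closedBall
      rintro _ ⟨z, ⟨hz, hzM⟩, rfl⟩
      have hz0 : 0 < ‖diskC h * z + diskD h‖ := norm_pos_iff.2 (diskC_mul_add_ne_zero h z)
      rw [Metric.mem_closedBall, dist_eq_norm, norm_toDisk_smul_sub_infty,
        div_le_iff₀ (by positivity)]
      have k := diskC_mul_norm_le hr.le h hz
      have k2 : z.im ≤ ‖(z : ℂ)‖ := Complex.im_le_norm _
      have k3 : M * (‖diskC h‖ ^ 2 * ε₁) = 4 * r := by rw [hM]; field_simp
      have k4 : ‖diskC h‖ * M ≤ r * ‖diskC h * z + diskD h‖ := by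
        refine le_trans ?_ k
        gcongr
        exact hzM.trans k2
      have k5 : (‖diskC h‖ * M) * (‖diskC h‖ * ε₁) ≤
        (r * ‖diskC h * z + diskD h‖) * (‖diskC h‖ * ε₁) := by gcongr
      have : r * 4 ≤ r * (‖diskC h * z + diskD h‖ * ‖diskC h‖ * ε₁) := by
        linear_combination k5 - k3
      have := le_of_mul_le_mul_left this hr
      linarith
    have := this hcl'
    rw [Metric.mem_closedBall] at this
    linarith
  · have : closure ((fun z : ℍ => toDisk (h • z)) '' {z ∈ cone r | z.im ≤ m}) ⊆
        Metric.closedBall (conj (diskD h) / diskD h) (ε₂ / 2) := by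
      apply closure_minimal _ Metric.isClosed_closedBall
      rintro _ ⟨z, ⟨hz, hzM⟩, rfl⟩
      have hz0 : 0 < ‖diskC h * z + diskD h‖ := norm_pos_iff.2 (diskC_mul_add_ne_zero h z)
      rw [Metric.mem_closedBall, dist_eq_norm, norm_toDisk_smul_sub_zero,
        div_le_iff₀ (by positivity)]
      have k := norm_diskD_le hr.le h hz
      have k2 : ‖(z : ℂ)‖ ≤ r * m := by
        refine le_trans hz ?_
        gcongr
      have k3 : m * (4 * (1 + r) * r) = ‖diskD h‖ ^ 2 * ε₂ := by rw [hm]; field_simp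
      have k4 : ‖diskD h‖ * (‖diskD h‖ * ε₂) ≤
        ((1 + r) * ‖diskC h * z + diskD h‖) * (‖diskD h‖ * ε₂) := by gcongr
      have k5 : (1 + r) * (4 * (r * m)) ≤ (1 + r) * (‖diskC h * z + diskD h‖ * ‖diskD h‖ * ε₂) := by
        linear_combination k4 + k3
      have := le_of_mul_le_mul_left k5 (by linarith)
      linarith
    have := this hcl'
    rw [Metric.mem_closedBall] at this
    linarith
  · have hcont : Continuous (fun z : ℍ => toDisk (h • z)) :=
      continuous_toDisk.comp (continuous_const_smul h)
    have hc := ((isCompact_slab r M hm0).image hcont).isClosed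
    rw [hc.closure_eq] at hcl'
    obtain ⟨z, -, rfl⟩ := hcl'
    exact (norm_toDisk_lt_one (h • z)).ne hξ

/-! ### Isometries with an axis -/

lemma mul_apply_two (g h : SL(2, ℝ)) (i j : Fin 2) :
    (g * h) i j = g i 0 * h 0 j + g i 1 * h 1 j := by
  rw [Matrix.SpecialLinearGroup.coe_mul, Matrix.mul_apply, Fin.sum_univ_two]

lemma smul_mem_cone_iff (μ : {x : ℝ // 0 < x}) {r : ℝ} {z : ℍ} : μ • z ∈ cone r ↔ z ∈ cone r := by
  have hμ := μ.2
  change ‖((μ • z : ℍ) : ℂ)‖ ≤ r * (μ • z).im ↔ ‖(z : ℂ)‖ ≤ r * z.im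
  rw [coe_pos_real_smul, pos_real_im, norm_smul, Real.norm_of_nonneg hμ.le, mul_left_comm]
  exact mul_le_mul_iff_right₀ hμ

/-- The half-turn `z ↦ -1 / z`. -/
def halfTurn : SL(2, ℝ) := ⟨!![0, -1; 1, 0], by simp⟩

lemma coe_halfTurn_smul (z : ℍ) : ((halfTurn • z : ℍ) : ℂ) = -(z : ℂ)⁻¹ := by
  rw [coe_smul_eq]
  simp [halfTurn, neg_div]

lemma halfTurn_smul_halfTurn_smul (z : ℍ) : halfTurn • halfTurn • z = z := by
  apply UpperHalfPlane.ext
  rw [coe_halfTurn_smul, coe_halfTurn_smul]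
  simp

lemma halfTurn_smul_dilation (μ : {x : ℝ // 0 < x}) (z : ℍ) :
    μ • halfTurn • z = halfTurn • μ⁻¹ • z := by
  have hμ := μ.2.ne'
  apply UpperHalfPlane.ext
  rw [coe_pos_real_smul, coe_halfTurn_smul, coe_halfTurn_smul, coe_pos_real_smul]
  simp [mul_comm]

lemma halfTurn_smul_mem_cone {r : ℝ} {z : ℍ} (hz : z ∈ cone r) : halfTurn • z ∈ cone r := by
  have hz0 : 0 < ‖(z : ℂ)‖ := norm_pos_iff.2 (UpperHalfPlane.ne_zero z)
  have h1 : ‖(z : ℂ)‖ ≤ r * z.im := hz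
  have him : (halfTurn • z).im = z.im / ‖(z : ℂ)‖ ^ 2 := by
    rw [← UpperHalfPlane.coe_im, coe_halfTurn_smul, Complex.neg_im, Complex.inv_im,
      Complex.normSq_eq_norm_sq]
    simp [neg_div]
  change ‖((halfTurn • z : ℍ) : ℂ)‖ ≤ r * (halfTurn • z).im
  rw [coe_halfTurn_smul, him, norm_neg, norm_inv, ← mul_div_assoc, le_div_iff₀ (by positivity)]
  rw [pow_two, inv_mul_cancel_left₀ hz0.ne']
  exact h1

lemma diskC_mul_halfTurn (h : SL(2, ℝ)) : diskC (h * halfTurn) = diskD h := by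
  simp only [diskC, diskD, mul_apply_two]
  simp [halfTurn]

/-- The isometry `g` translates along the axis `h (0, ∞)`. -/
def IsTranslation (g h : SL(2, ℝ)) (μ : {x : ℝ // 0 < x}) : Prop :=
  ∀ z : ℍ, g • h • z = h • μ • z

namespace IsTranslation

variable {g h : SL(2, ℝ)} {μ : {x : ℝ // 0 < x}}

lemma inv (H : IsTranslation g h μ) : IsTranslation g⁻¹ h μ⁻¹ := fun z => by
  rw [inv_smul_eq_iff, H, smul_inv_smul]

lemma pow (H : IsTranslation g h μ) (n : ℕ) : IsTranslation (g ^ n) h (μ ^ n) := by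
  induction n with
  | zero => intro z; simp
  | succ n ih => intro z; rw [pow_succ, pow_succ, mul_smul, mul_smul, H, ih]

lemma zpow (H : IsTranslation g h μ) (n : ℤ) : IsTranslation (g ^ n) h (μ ^ n) := by
  cases n with
  | ofNat n => simpa using H.pow n
  | negSucc n => simpa using (H.pow (n + 1)).inv

lemma conjugate (H : IsTranslation g h μ) (γ : SL(2, ℝ)) :
    IsTranslation (γ * g * γ⁻¹) (γ * h) μ := fun z => by
  simp only [mul_smul, inv_smul_smul, H z]

/-- The half-turn exchanges `0` and `∞`. Inverting `g` as well preserves the factor `μ`, so either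
end of an axis can be placed at `∞` while keeping `1 < μ`. -/
lemma mul_halfTurn (H : IsTranslation g h μ) : IsTranslation g⁻¹ (h * halfTurn) μ := fun z => by
  rw [mul_smul, H.inv, halfTurn_smul_dilation, inv_inv, mul_smul]

lemma mul_halfTurn' (H : IsTranslation g h μ) : IsTranslation g (h * halfTurn) μ⁻¹ := fun z => by
  rw [mul_smul, H, halfTurn_smul_dilation, mul_smul]

end IsTranslation

/-- The eigenvalues are real and distinct. The columns of `h` are eigenvectors, and the diagonal
matrix with entries `l`, `l⁻¹` acts as dilation by `l ^ 2`. -/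
lemma exists_isTranslation_ne_one (g : SL(2, ℝ)) (hg : 4 < (g 0 0 + g 1 1) ^ 2) :
    ∃ h μ, μ ≠ 1 ∧ IsTranslation g h μ := by
  have hd := det_eq_one g
  suffices H : ∃ (h : SL(2, ℝ)) (l k : ℝ), l * k = 1 ∧ l ≠ k ∧
      g 0 0 * h 0 0 + g 0 1 * h 1 0 = h 0 0 * l ∧ g 1 0 * h 0 0 + g 1 1 * h 1 0 = h 1 0 * l ∧
      g 0 0 * h 0 1 + g 0 1 * h 1 1 = h 0 1 * k ∧ g 1 0 * h 0 1 + g 1 1 * h 1 1 = h 1 1 * k by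
    obtain ⟨h, l, k, hlk, hne, e1, e2, e3, e4⟩ := H
    have hl : l ≠ 0 := left_ne_zero_of_mul_eq_one hlk
    have hk : k = l⁻¹ := eq_inv_of_mul_eq_one_right hlk
    refine ⟨h, ⟨l ^ 2, by positivity⟩, ?_, ?_⟩
    · intro h1
      have h1 : l ^ 2 = 1 := congrArg Subtype.val h1
      apply hne
      rw [hk]
      field_simp
      exact h1
    · intro z
      let D : SL(2, ℝ) := ⟨!![l, 0; 0, k], by simp [hlk]⟩
      have hgh : g * h = h * D := by
        ext i j
        rw [mul_apply_two, mul_apply_two]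
        fin_cases i <;> fin_cases j <;> simp [D, e1, e2, e3, e4]
      have hD : (⟨l ^ 2, by positivity⟩ : {x : ℝ // 0 < x}) • z = D • z := by
        apply UpperHalfPlane.ext
        rw [coe_pos_real_smul, coe_smul_eq]
        have : (l : ℂ) ≠ 0 := by exact_mod_cast hl
        simp [D, hk]
        ring
      rw [hD, ← mul_smul, hgh, mul_smul]
  by_cases hc : g 1 0 = 0
  · rw [hc] at hd
    have hne : g 1 1 - g 0 0 ≠ 0 := by
      intro h0
      have : g 1 1 = g 0 0 := by linarith
      rw [this] at hd hg
      nlinarith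
    refine ⟨⟨!![1, g 0 1 / (g 1 1 - g 0 0); 0, 1], by simp⟩, g 0 0, g 1 1, by linarith,
      fun h => hne (by rw [h, sub_self]), ?_, ?_, ?_, ?_⟩ <;> simp [hc]
    field_simp
    ring
  · set s : ℝ := √((g 0 0 + g 1 1) ^ 2 - 4) with hs
    have hs2 : s ^ 2 = (g 0 0 + g 1 1) ^ 2 - 4 := Real.sq_sqrt (by linarith)
    have hs0 : 0 < s := Real.sqrt_pos.2 (by linarith)
    -- Eigenvectors with lower entry `1`, the second rescaled by `g 1 0 / s` to make the determinant
    -- `1`.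
    refine ⟨⟨!![(g 0 0 - g 1 1 + s) / (2 * g 1 0), (g 0 0 - g 1 1 - s) / (2 * s); 1, g 1 0 / s], ?_⟩,
      (g 0 0 + g 1 1 + s) / 2, (g 0 0 + g 1 1 - s) / 2, by linarith, fun h => ?_, ?_, ?_, ?_, ?_⟩
    · rw [Matrix.det_fin_two_of]
      field_simp
      ring
    · linarith
    all_goals simp
    all_goals field_simp
    · linear_combination -4 * hd - hs2
    · ring
    · linear_combination -4 * hd - hs2
    · ring

lemma exists_isTranslation (g : SL(2, ℝ)) (hg : 4 < (g 0 0 + g 1 1) ^ 2) :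
    ∃ h μ, 1 < μ ∧ IsTranslation g h μ := by
  obtain ⟨h, μ, hμ, H⟩ := exists_isTranslation_ne_one g hg
  rcases lt_or_gt_of_ne hμ with h1 | h1
  · exact ⟨_, μ⁻¹, one_lt_inv'.2 h1, H.mul_halfTurn'⟩
  · exact ⟨h, μ, h1, H⟩

/-! ### Elements of surface groups are translations -/

/-- In the formula for `sinh (d / 2)` the factors `‖c z + d‖` cancel, and `x ≤ sinh x`. The
polynomial in the bound vanishes exactly at fixed points. -/
lemma dist_smul_le (g : SL(2, ℝ)) (z : ℍ) :
    dist z (g • z) ≤ ‖(g 1 0 : ℂ) * z ^ 2 + (g 1 1 - g 0 0) * z - g 0 1‖ / z.im := by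
  have hq := smul_denom_ne_zero g z
  have hq0 : 0 < ‖(g 1 0 : ℂ) * z + g 1 1‖ := norm_pos_iff.2 hq
  have hz := z.im_pos
  have him : (g • z).im = z.im / ‖(g 1 0 : ℂ) * z + g 1 1‖ ^ 2 := by
    have hd := det_eq_one g
    rw [← UpperHalfPlane.coe_im, coe_smul_eq, Complex.div_im, ← sub_div,
      Complex.normSq_eq_norm_sq]
    congr 1
    simp
    linear_combination (z.im) * hd
  have hdist : dist (z : ℂ) (g • z : ℍ) =
      ‖(g 1 0 : ℂ) * z ^ 2 + (g 1 1 - g 0 0) * z - g 0 1‖ / ‖(g 1 0 : ℂ) * z + g 1 1‖ := by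
    rw [dist_eq_norm, ← norm_div, coe_smul_eq]
    congr 1
    rw [eq_div_iff hq, sub_mul, div_mul_cancel₀ _ hq]
    ring
  have hsq : √(z.im * (g • z).im) = z.im / ‖(g 1 0 : ℂ) * z + g 1 1‖ := by
    rw [him, show z.im * (z.im / ‖(g 1 0 : ℂ) * z + g 1 1‖ ^ 2) =
      (z.im / ‖(g 1 0 : ℂ) * z + g 1 1‖) ^ 2 by ring]
    exact Real.sqrt_sq (by positivity)
  have h1 := sinh_half_dist z (g • z)
  have h2 : dist z (g • z) / 2 ≤ Real.sinh (dist z (g • z) / 2) :=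
    Real.self_le_sinh_iff.2 (by positivity)
  rw [h1, hsq, hdist] at h2
  have h3 : ‖(g 1 0 : ℂ) * z ^ 2 + (g 1 1 - g 0 0) * z - g 0 1‖ / ‖(g 1 0 : ℂ) * z + g 1 1‖ /
    (2 * (z.im / ‖(g 1 0 : ℂ) * z + g 1 1‖)) =
    ‖(g 1 0 : ℂ) * z ^ 2 + (g 1 1 - g 0 0) * z - g 0 1‖ / z.im / 2 := by
    field_simp
  rw [h3] at h2
  linarith

lemma exists_dist_smul_le (g : SL(2, ℝ)) (hg : (g 0 0 + g 1 1) ^ 2 ≤ 4) {ε : ℝ} (hε : 0 < ε) :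
    ∃ z : ℍ, dist z (g • z) ≤ ε := by
  have hd := det_eq_one g
  suffices H : ∃ z : ℍ, ‖(g 1 0 : ℂ) * z ^ 2 + (g 1 1 - g 0 0) * z - g 0 1‖ ≤ ε * z.im by
    obtain ⟨z, hz⟩ := H
    exact ⟨z, (dist_smul_le g z).trans ((div_le_iff₀ z.im_pos).2 hz)⟩
  by_cases hc : g 1 0 = 0
  · rw [hc] at hd
    have h1 : (g 0 0 - g 1 1) ^ 2 ≤ 0 := by nlinarith
    have h2 : g 1 1 = g 0 0 := by nlinarith
    have hy : 0 < (|g 0 1| + 1) / ε := by positivity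
    refine ⟨⟨⟨0, (|g 0 1| + 1) / ε⟩, hy⟩, ?_⟩
    rw [hc, h2]
    simp only [Complex.ofReal_zero, zero_mul, sub_self, zero_sub, zero_add, norm_neg,
      Complex.norm_real, Real.norm_eq_abs]
    change |g 0 1| ≤ ε * ((|g 0 1| + 1) / ε)
    rw [mul_div_cancel₀ _ hε.ne']
    linarith
  · have hc' : 0 < |g 1 0| := abs_pos.2 hc
    -- On this vertical line the fixed-point polynomial is real. If the squared trace is below `4`,
    -- `y` is the height of the fixed point; if it equals `4`, any small `y` will do.
    have key : ∀ y : ℝ, 0 < y → |(4 - (g 0 0 + g 1 1) ^ 2) / (4 * g 1 0) - g 1 0 * y ^ 2| ≤ ε * y →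
        ∃ z : ℍ, ‖(g 1 0 : ℂ) * z ^ 2 + (g 1 1 - g 0 0) * z - g 0 1‖ ≤ ε * z.im := by
      intro y hy hle
      refine ⟨⟨⟨(g 0 0 - g 1 1) / (2 * g 1 0), y⟩, hy⟩, ?_⟩
      have : (g 1 0 : ℂ) * (⟨(g 0 0 - g 1 1) / (2 * g 1 0), y⟩ : ℂ) ^ 2 +
          (g 1 1 - g 0 0) * (⟨(g 0 0 - g 1 1) / (2 * g 1 0), y⟩ : ℂ) - g 0 1 =
          (((4 - (g 0 0 + g 1 1) ^ 2) / (4 * g 1 0) - g 1 0 * y ^ 2 : ℝ) : ℂ) := by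
        apply Complex.ext
        · rw [Complex.ofReal_re]
          simp [pow_two]
          field_simp
          linear_combination 16 * hd
        · rw [Complex.ofReal_im]
          simp [pow_two]
          field_simp
          ring
      change ‖(g 1 0 : ℂ) * (⟨(g 0 0 - g 1 1) / (2 * g 1 0), y⟩ : ℂ) ^ 2 +
          (g 1 1 - g 0 0) * (⟨(g 0 0 - g 1 1) / (2 * g 1 0), y⟩ : ℂ) - g 0 1‖ ≤ ε * y
      rw [this, Complex.norm_real]
      exact hle
    rcases eq_or_lt_of_le hg with h4 | h4
    · refine key (ε / |g 1 0|) (by positivity) ?_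
      rw [h4, sub_self, zero_div, zero_sub, abs_neg, abs_mul, abs_pow, abs_div, abs_abs,
        abs_of_pos hε]
      apply le_of_eq
      field_simp
    · refine key (√(4 - (g 0 0 + g 1 1) ^ 2) / (2 * |g 1 0|))
        (div_pos (Real.sqrt_pos.2 (by linarith)) (by positivity)) ?_
      rw [div_pow, Real.sq_sqrt (by linarith), mul_pow, sq_abs]
      have : (4 - (g 0 0 + g 1 1) ^ 2) / (4 * g 1 0) -
        g 1 0 * ((4 - (g 0 0 + g 1 1) ^ 2) / (2 ^ 2 * g 1 0 ^ 2)) = 0 := by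
        field_simp
        ring
      rw [this, abs_zero]
      positivity

namespace IsClosedSurfaceGroup

variable {Γ : Subgroup SL(2, ℝ)} (hΓ : IsClosedSurfaceGroup Γ)
include hΓ

lemma finite_inter {K L : Set ℍ} (hK : IsCompact K) (hL : IsCompact L) :
    {γ : Γ | ∃ z ∈ K, γ • z ∈ L}.Finite := by
  have := hΓ.discrete
  refine (ProperlyDiscontinuousSMul.finite_disjoint_inter_image (Γ := Γ) hK hL).subset ?_
  rintro γ ⟨z, hz, hzL⟩
  exact ⟨γ • z, ⟨z, hz, rfl⟩, hzL⟩

lemma exists_compact : ∃ K : Set ℍ, IsCompact K ∧ ∀ z : ℍ, ∃ γ : Γ, γ • z ∈ K := by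
  have := hΓ.compact
  have hopen : IsOpenMap (proj Γ) := isOpenMap_quotient_mk'_mul
  obtain ⟨n, hn⟩ := (isCompact_univ (X := Surface Γ)).elim_directed_cover
    (fun n : ℕ => proj Γ '' Metric.ball UpperHalfPlane.I n)
    (fun n => hopen _ Metric.isOpen_ball)
    (by
      intro x _
      obtain ⟨z, rfl⟩ := Quotient.exists_rep x
      obtain ⟨n, hn⟩ := exists_nat_gt (dist z UpperHalfPlane.I)
      exact Set.mem_iUnion.2 ⟨n, z, hn, rfl⟩)
    (directed_of_isDirected_le fun m n hmn =>
      Set.image_mono (Metric.ball_subset_ball (by exact_mod_cast hmn)))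
  refine ⟨Metric.closedBall UpperHalfPlane.I n, isCompact_closedBall _ _, fun z => ?_⟩
  obtain ⟨w, hw, hwz⟩ := hn (Set.mem_univ (proj Γ z))
  obtain ⟨γ, hγ⟩ := MulAction.orbitRel_apply.1 (Quotient.exact hwz)
  exact ⟨γ, by rw [show γ • z = w from hγ]; exact Metric.ball_subset_closedBall hw⟩

/-- Conjugation moves `z` into a compact `K`. An element displacing a point of `K` by less than `1`
is one of finitely many, and each of these that acts nontrivially has no fixed point, hence positive
minimal displacement on `K`. -/
lemma exists_le_dist : ∃ δ > 0, ∀ γ ∈ Γ, (∃ z : ℍ, γ • z ≠ z) → ∀ z : ℍ, δ ≤ dist z (γ • z) := by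
  obtain ⟨K, hK, hKΓ⟩ := hΓ.exists_compact
  have hK' : IsCompact (Metric.cthickening 1 K) := hK.cthickening
  have hF := hΓ.finite_inter hK' hK'
  have h1 : ∀ᶠ δ in 𝓝[>] (0 : ℝ), ∀ γ ∈ {γ : Γ | ∃ z ∈ Metric.cthickening 1 K,
      γ • z ∈ Metric.cthickening 1 K}, (∃ z : ℍ, γ • z ≠ z) → ∀ z ∈ K, δ ≤ dist z (γ • z) := by
    rw [eventually_all_finite hF]
    intro γ _
    by_cases hγ : ∃ z : ℍ, γ • z ≠ z
    · rcases K.eq_empty_or_nonempty with rfl | hne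
      · simp
      obtain ⟨z₀, -, hmin⟩ := hK.exists_isMinOn hne
        (f := fun z => dist z (γ • z)) (by fun_prop)
      have hpos : 0 < dist z₀ (γ • z₀) := by
        refine dist_pos.2 fun h => ?_
        obtain ⟨z, hz⟩ := hγ
        exact hz (hΓ.free γ γ.2 ⟨z₀, h.symm⟩ z)
      filter_upwards [Ioo_mem_nhdsGT hpos] with δ hδ _ z hz
      exact hδ.2.le.trans (hmin hz)
    · exact Eventually.of_forall fun δ h => absurd h hγ
  obtain ⟨δ, hδ, hδ1⟩ := (h1.and (Ioo_mem_nhdsGT (zero_lt_one))).exists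
  refine ⟨δ, hδ1.1, fun γ hγ hne z => ?_⟩
  by_contra! hlt
  obtain ⟨γ₀, hγ₀⟩ := hKΓ z
  set γ' : Γ := γ₀ * ⟨γ, hγ⟩ * γ₀⁻¹ with hγ'
  have e1 : γ' • γ₀ • z = γ₀ • γ • z := by
    simp only [hγ', mul_smul, inv_smul_smul]
    rfl
  have e2 : dist (γ₀ • z) (γ' • γ₀ • z) = dist z (γ • z) := by
    rw [e1]
    exact dist_smul (γ₀ : SL(2, ℝ)) z (γ • z)
  have hmem : ∃ z ∈ Metric.cthickening 1 K, γ' • z ∈ Metric.cthickening 1 K := by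
    refine ⟨γ₀ • z, Metric.self_subset_cthickening K hγ₀, ?_⟩
    refine Metric.mem_cthickening_of_dist_le _ (γ₀ • z) 1 K hγ₀ ?_
    rw [dist_comm, e2]
    linarith [hδ1.2]
  have hne' : ∃ z : ℍ, γ' • z ≠ z := by
    obtain ⟨w, hw⟩ := hne
    refine ⟨γ₀ • w, fun h => hw ?_⟩
    have : γ' • γ₀ • w = γ₀ • γ • w := by
      simp only [hγ', mul_smul, inv_smul_smul]
      rfl
    rw [this] at h
    exact smul_left_cancel γ₀ h
  have := hδ γ' hmem hne' _ hγ₀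
  rw [e2] at this
  linarith

lemma exists_isTranslation {γ : SL(2, ℝ)} (hγ : γ ∈ Γ) (hne : ∃ z : ℍ, γ • z ≠ z) :
    ∃ h μ, 1 < μ ∧ IsTranslation γ h μ := by
  apply FLOiation.exists_isTranslation
  by_contra! h4
  obtain ⟨δ, hδ, H⟩ := hΓ.exists_le_dist
  obtain ⟨z, hz⟩ := exists_dist_smul_le γ h4 (half_pos hδ)
  linarith [H γ hγ hne z]

end IsClosedSurfaceGroup

/-! ### The universal covering and lifts of edges -/

namespace IsClosedSurfaceGroup

variable {Γ : Subgroup SL(2, ℝ)} (hΓ : IsClosedSurfaceGroup Γ)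
include hΓ

lemma isCoveringMap_proj : IsCoveringMap (proj Γ) := by
  have := hΓ.discrete
  -- Elements such as `-1` may act trivially, so `Γ` is replaced by its image in the permutations of
  -- `ℍ`, which acts freely.
  suffices H : IsQuotientCoveringMap (proj Γ) (MulAction.toPermHom Γ ℍ).range from
    H.isCoveringMap
  refine (isQuotientCoveringMap_iff _ _).2 ⟨isQuotientMap_quotient_mk', ⟨?_⟩, ?_, ?_⟩
  · rintro ⟨_, γ, rfl⟩
    exact continuous_const_smul γ
  · intro z w
    refine (Quotient.eq (r := MulAction.orbitRel Γ ℍ)).trans ?_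
    rw [MulAction.orbitRel_apply]
    constructor
    · rintro ⟨γ, hγ⟩
      exact ⟨⟨_, γ, rfl⟩, hγ⟩
    · rintro ⟨⟨_, γ, rfl⟩, hγ⟩
      exact ⟨γ, hγ⟩
  · intro z
    obtain ⟨U, hU, H⟩ := ProperlyDiscontinuousSMul.exists_nhds_image_smul_eq_self Γ z
    refine ⟨U, hU, ?_⟩
    rintro ⟨_, γ, rfl⟩ hne
    have hz : γ • z = z := H γ hne
    ext w : 2
    exact hΓ.free γ γ.2 ⟨z, hz⟩ w

lemma smul_eq_smul_of_smul_eq_smul {γ γ' : Γ} {z : ℍ} (h : γ • z = γ' • z) (w : ℍ) :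
    γ • w = γ' • w := by
  have h1 : (γ'⁻¹ * γ) • z = z := by rw [mul_smul, h, inv_smul_smul]
  have h2 : (γ'⁻¹ * γ) • w = w := hΓ.free _ (γ'⁻¹ * γ).2 ⟨z, h1⟩ w
  rwa [mul_smul, inv_smul_eq_iff] at h2

lemma isClosed_biUnion_smul {K : Set ℍ} (hK : IsCompact K) (S : Set Γ) :
    IsClosed (⋃ γ : S, (γ : Γ) • K) := by
  have hlf : LocallyFinite (fun γ : Γ => γ • K) := by
    intro x
    obtain ⟨N, hN, hxN⟩ := exists_compact_mem_nhds x
    refine ⟨N, hxN, (hΓ.finite_inter hK hN).subset ?_⟩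
    rintro γ ⟨_, ⟨z, hz, rfl⟩, hzN⟩
    exact ⟨z, hz, hzN⟩
  refine (hlf.comp_injective (Subtype.val_injective (p := (· ∈ S)))).isClosed_iUnion fun γ => ?_
  exact (hK.image (continuous_const_smul (γ : Γ))).isClosed

end IsClosedSurfaceGroup

/-- A closed lift contracts in the simply connected cover, and the contraction projects. Hence lifts
of essential edges are not closed. -/
lemma homotopic_refl_of_closed_lift {E X : Type*} [TopologicalSpace E] [TopologicalSpace X]
    [SimplyConnectedSpace E] {p : E → X} (hp : Continuous p) {v : X} (e : Path v v) (f : C(I, E))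
    (hf : ∀ s, p (f s) = e s) (h : f 1 = f 0) : e.Homotopic (Path.refl v) := by
  obtain rfl : p (f 0) = v := by simp [hf]
  let q : Path (f 0) (f 0) := ⟨f, rfl, h⟩
  have hq : e = q.map hp := by
    ext s
    exact (hf s).symm
  have h1 : q.Homotopic (Path.refl (f 0)) := SimplyConnectedSpace.paths_homotopic _ _
  have h2 : (q.map hp).Homotopic ((Path.refl (f 0)).map hp) := h1.map ⟨p, hp⟩
  rw [hq]
  exact h2

namespace OneVertexTriangulation

variable {X : Type} [TopologicalSpace X] (Δ : OneVertexTriangulation X)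

lemma edge_ne_vertex (a : Δ.Edge) {s : I} (hs : s ∈ Set.Ioo (0 : I) 1) :
    Δ.edge a s ≠ Δ.vertex := by
  intro h
  obtain ⟨c, -, hc⟩ := Δ.partition Δ.vertex
  have h1 := hc (.inl ()) rfl
  have h2 := hc (.inr (.inl a)) ⟨s, hs, h⟩
  rw [← h2] at h1
  cases h1

lemma edge_eq_edge (a : Δ.Edge) {s s' : I} (h : Δ.edge a s = Δ.edge a s') :
    s = s' ∨ ((s = 0 ∨ s = 1) ∧ (s' = 0 ∨ s' = 1)) := by
  have hend : ∀ t : I, t ∈ Set.Ioo (0 : I) 1 ∨ (t = 0 ∨ t = 1) := by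
    intro t
    rcases eq_or_ne t 0 with h0 | h0
    · exact Or.inr (Or.inl h0)
    rcases eq_or_ne t 1 with h1 | h1
    · exact Or.inr (Or.inr h1)
    · exact Or.inl ⟨unitInterval.pos_iff_ne_zero.2 h0, unitInterval.lt_one_iff_ne_one.2 h1⟩
  have hv : ∀ t : I, (t = 0 ∨ t = 1) → Δ.edge a t = Δ.vertex := by
    rintro t (rfl | rfl) <;> simp
  rcases hend s with hs | hs <;> rcases hend s' with hs' | hs'
  · exact Or.inl (Δ.edge_injOn a hs hs' h)
  · exact absurd (h.trans (hv s' hs')) (Δ.edge_ne_vertex a hs)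
  · exact absurd (h.symm.trans (hv s hs)) (Δ.edge_ne_vertex a hs')
  · exact Or.inr ⟨hs, hs'⟩

end OneVertexTriangulation

/-- All walls over an edge are translates of the union of the translates of a compact arc under
the powers of a deck transformation. -/
lemma exists_wall_structure {Γ : Subgroup SL(2, ℝ)} (hΓ : IsClosedSurfaceGroup Γ)
    (Δ : OneVertexTriangulation (Surface Γ)) (hΔ : Δ.IsEssential) (a : Δ.Edge) :
    ∃ (K : Set ℍ) (g : Γ), IsCompact K ∧ K.Nonempty ∧ (∃ z : ℍ, g • z ≠ z) ∧
      ∀ z ∈ proj Γ ⁻¹' Set.range (Δ.edge a), ∃ γ : Γ,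
        connectedComponentIn (proj Γ ⁻¹' Set.range (Δ.edge a)) z = γ • ⋃ n : ℤ, g ^ n • K := by
  have hcov := hΓ.isCoveringMap_proj
  obtain ⟨z₀, hz₀⟩ := Quotient.exists_rep Δ.vertex
  obtain ⟨f, hf, -⟩ := hcov.exists_path_lifts (Δ.edge a : C(I, Surface Γ)) z₀
    ((Δ.edge a).source.trans hz₀.symm)
  have hf : ∀ s, proj Γ (f s) = Δ.edge a s := fun s => congrFun hf s
  have hrel : ∀ z w : ℍ, proj Γ z = proj Γ w → ∃ γ : Γ, γ • w = z := fun z w h =>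
    MulAction.orbitRel_apply.1 (Quotient.exact h)
  have hinv : ∀ (γ : Γ) (z : ℍ), proj Γ (γ • z) = proj Γ z := fun γ z =>
    Quotient.sound (MulAction.orbitRel_apply.2 ⟨γ, rfl⟩)
  obtain ⟨g, hg⟩ := hrel (f 1) (f 0) (by simp [hf])
  set K : Set ℍ := Set.range f with hK
  have hKc : IsCompact K := isCompact_range f.continuous
  have hpow : ∀ s s' : I, Δ.edge a s = Δ.edge a s' → ∃ m : ℤ, g ^ m • f s = f s' := by
    intro s s' h
    rcases Δ.edge_eq_edge a h with rfl | ⟨rfl | rfl, rfl | rfl⟩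
    · exact ⟨0, by simp⟩
    · exact ⟨0, by simp⟩
    · exact ⟨1, by simp [hg]⟩
    · exact ⟨-1, by simp [← hg]⟩
    · exact ⟨0, by simp⟩
  refine ⟨K, g, hKc, Set.range_nonempty f, ⟨f 0, fun h => hΔ a ?_⟩, fun z hz => ?_⟩
  · exact homotopic_refl_of_closed_lift hcov.continuous _ f hf (by rw [← hg, h])
  set P := proj Γ ⁻¹' Set.range (Δ.edge a) with hP
  obtain ⟨s, hs⟩ := hz
  obtain ⟨γ, hγ⟩ := hrel z (f s) (by rw [hf, hs])
  refine ⟨γ, ?_⟩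
  have hzP : z ∈ P := ⟨s, hs⟩
  set A : Set ℍ := γ • ⋃ n : ℤ, g ^ n • K with hA
  have hAeq : A = ⋃ n : ℤ, (γ * g ^ n) • K := by
    rw [hA, Set.smul_set_iUnion]
    simp only [mul_smul]
  have hzA : z ∈ A := by
    rw [hAeq]
    exact Set.mem_iUnion.2 ⟨0, f s, ⟨s, rfl⟩, by simpa using hγ⟩
  have hAP : A ⊆ P := by
    rw [hAeq]
    refine Set.iUnion_subset fun n => ?_
    rintro _ ⟨_, ⟨t, rfl⟩, rfl⟩
    exact ⟨t, by rw [hinv, hf]⟩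
  have hApre : IsPreconnected A := by
    rw [hAeq]
    refine IsPreconnected.iUnion_of_chain (fun n => ?_) (fun n => ?_)
    · exact (isPreconnected_range f.continuous).image _
        (continuous_const_smul (γ * g ^ n)).continuousOn
    · refine ⟨(γ * g ^ n) • f 1, ⟨f 1, ⟨1, rfl⟩, rfl⟩, f 0, ⟨0, rfl⟩, ?_⟩
      simp only [Order.succ_eq_add_one]
      rw [zpow_add_one, ← mul_assoc, mul_smul (γ * g ^ n) g, hg]
  apply Set.Subset.antisymm
  · have hAcl : IsClosed A := by
      have : A = ⋃ δ : Set.range (fun n : ℤ => γ * g ^ n), (δ : Γ) • K := by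
        rw [hAeq]
        ext w
        simp
      rw [this]
      exact hΓ.isClosed_biUnion_smul hKc _
    -- The translates of the arc disjoint from `A` form a second closed set `B`; as `A` and `B`
    -- cover the preimage of the edge, the component of `z` lies in `A`.
    set S : Set Γ := {δ | Disjoint (δ • K) A}
    have hB := hΓ.isClosed_biUnion_smul hKc S
    set B : Set ℍ := ⋃ δ : S, (δ : Γ) • K with hBdef
    have hAB : Disjoint A B := by
      rw [hBdef, Set.disjoint_iUnion_right]
      exact fun δ => δ.2.symm
    have hdich : ∀ δ : Γ, δ • K ⊆ A ∨ δ ∈ S := by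
      intro δ
      by_cases hδ : Disjoint (δ • K) A
      · exact Or.inr hδ
      left
      obtain ⟨w, ⟨_, ⟨t, rfl⟩, rfl⟩, hwA⟩ := Set.not_disjoint_iff.1 hδ
      rw [hAeq] at hwA ⊢
      obtain ⟨n, _, ⟨t', rfl⟩, hn⟩ := Set.mem_iUnion.1 hwA
      have hn : (γ * g ^ n) • f t' = δ • f t := hn
      -- Translates of the arc meet only over one point of the edge, so their parameters differ by a
      -- power of `g`; freeness then identifies the two translates.
      obtain ⟨m, hm⟩ := hpow t t' (by rw [← hf, ← hf, ← hinv δ, ← hn, hinv])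
      rw [← hm, ← mul_smul, mul_assoc, ← zpow_add] at hn
      have hall := hΓ.smul_eq_smul_of_smul_eq_smul hn
      refine Set.Subset.trans ?_ (Set.subset_iUnion _ (n + m))
      rintro _ ⟨k, hk, rfl⟩
      exact ⟨k, hk, hall k⟩
    have hsub : connectedComponentIn P z ⊆ A ∪ B := by
      refine (connectedComponentIn_subset P z).trans ?_
      rintro w ⟨t, ht⟩
      obtain ⟨δ, rfl⟩ := hrel w (f t) (by rw [hf, ht])
      rcases hdich δ with h | h
      · exact Or.inl (h ⟨f t, ⟨t, rfl⟩, rfl⟩)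
      · exact Or.inr (Set.mem_iUnion.2 ⟨⟨δ, h⟩, f t, ⟨t, rfl⟩, rfl⟩)
    have hcon := isPreconnected_closed_iff.1
      (isPreconnected_connectedComponentIn (x := z) (F := P)) A B hAcl hB hsub
      ⟨z, mem_connectedComponentIn hzP, hzA⟩
    intro w hw
    rcases hsub hw with h | h
    · exact h
    · obtain ⟨x, -, hx⟩ := hcon ⟨w, hw, h⟩
      exact (Set.disjoint_iff.1 hAB hx).elim
  · exact hApre.subset_connectedComponentIn hzA hAP

/-! ### Sets invariant under a translation and close to its axis -/

/-- The set `V` is invariant under an element of `Γ` which translates along the axis `h (0, ∞)`,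
and stays at bounded distance from this axis. -/
structure IsAxial (Γ : Subgroup SL(2, ℝ)) (r M : ℝ) (V : Set ℍ) (h : SL(2, ℝ)) : Prop where
  nonempty : V.Nonempty
  translation : ∃ g ∈ Γ, ∃ μ : {x : ℝ // 0 < x}, 1 < μ ∧ (μ : ℝ) ≤ M ∧ IsTranslation g h μ ∧
    g • V = V
  mem_cone : ∀ z ∈ V, h⁻¹ • z ∈ cone r

namespace IsAxial

variable {Γ : Subgroup SL(2, ℝ)} {r M : ℝ} {V : Set ℍ} {h : SL(2, ℝ)}

lemma mono {r' M' : ℝ} (H : IsAxial Γ r M V h) (hr : r ≤ r') (hM : M ≤ M') :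
    IsAxial Γ r' M' V h where
  nonempty := H.nonempty
  translation := by
    obtain ⟨g, hg, μ, h1, h2, h3⟩ := H.translation
    exact ⟨g, hg, μ, h1, h2.trans hM, h3⟩
  mem_cone z hz := cone_mono hr (H.mem_cone z hz)

lemma smul (H : IsAxial Γ r M V h) {γ : SL(2, ℝ)} (hγ : γ ∈ Γ) :
    IsAxial Γ r M (γ • V) (γ * h) where
  nonempty := H.nonempty.smul_set
  translation := by
    obtain ⟨g, hg, μ, h1, h2, h3, h4⟩ := H.translation
    refine ⟨γ * g * γ⁻¹, Γ.mul_mem (Γ.mul_mem hγ hg) (Γ.inv_mem hγ), μ, h1, h2, h3.conjugate γ, ?_⟩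
    rw [mul_smul, mul_smul, inv_smul_smul, h4]
  mem_cone := by
    rintro _ ⟨z, hz, rfl⟩
    simpa [mul_smul] using H.mem_cone z hz

lemma halfTurn (H : IsAxial Γ r M V h) : IsAxial Γ r M V (h * halfTurn) where
  nonempty := H.nonempty
  translation := by
    obtain ⟨g, hg, μ, h1, h2, h3, h4⟩ := H.translation
    exact ⟨g⁻¹, Γ.inv_mem hg, μ, h1, h2, h3.mul_halfTurn, by rw [inv_smul_eq_iff, h4]⟩
  mem_cone z hz := by
    rw [mul_inv_rev, mul_smul,
      show FLOiation.halfTurn⁻¹ • h⁻¹ • z = FLOiation.halfTurn • h⁻¹ • z by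
        rw [inv_smul_eq_iff, halfTurn_smul_halfTurn_smul]]
    exact halfTurn_smul_mem_cone (H.mem_cone z hz)

lemma zpow_smul_eq {g : SL(2, ℝ)} (hg : g • V = V) (n : ℤ) : g ^ n • V = V :=
  (MulAction.stabilizer SL(2, ℝ) V).zpow_mem hg n

/-- Only finitely many translates of an axial set have an axis which passes at bounded distance
from a compact set. -/
lemma finite_translates (hΓ : IsClosedSurfaceGroup Γ) (H : IsAxial Γ r M V h) (r' : ℝ) {K : Set ℍ}
    (hK : IsCompact K) : {W | ∃ γ ∈ Γ, W = γ • V ∧ ∃ w ∈ cone r', γ • h • w ∈ K}.Finite := by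
  obtain ⟨g, hg, μ, h1, h2, h3, h4⟩ := H.translation
  have hμ : (1 : ℝ) < μ := h1
  have hc : IsCompact ((fun z : ℍ => h • z) '' slab r' 1 μ) :=
    (isCompact_slab r' _ zero_lt_one).image (continuous_const_smul h)
  refine ((hΓ.finite_inter hc hK).image (fun γ : Γ => (γ : SL(2, ℝ)) • V)).subset ?_
  rintro W ⟨γ, hγ, rfl, w, hw, hwK⟩
  -- Passing from `γ` to `γ * g ^ n` does not change `γ • V` and brings `w` to height between `1`
  -- and `μ`.
  obtain ⟨n, hn1, hn2⟩ := exists_mem_Ico_zpow w.im_pos hμ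
  have hpos : (0 : ℝ) < (μ : ℝ) ^ n := zpow_pos μ.2 n
  refine ⟨⟨γ * g ^ n, Γ.mul_mem hγ (Γ.zpow_mem hg n)⟩, ⟨h • (μ ^ n)⁻¹ • w, ?_, ?_⟩, ?_⟩
  · refine ⟨_, ⟨smul_mem_cone_iff _ |>.2 hw, ?_, ?_⟩, rfl⟩
    · rw [pos_real_im, Positive.coe_inv, Positive.coe_zpow, inv_mul_eq_div, le_div_iff₀ hpos]
      linarith
    · rw [pos_real_im, Positive.coe_inv, Positive.coe_zpow, inv_mul_eq_div, div_le_iff₀ hpos]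
      rw [zpow_add_one₀ μ.2.ne'] at hn2
      linarith
  · change (γ * g ^ n) • h • (μ ^ n)⁻¹ • w ∈ K
    rw [mul_smul, h3.zpow n, smul_inv_smul]
    exact hwK
  · change (γ * g ^ n) • V = γ • V
    rw [mul_smul, zpow_smul_eq h4]

lemma finite_translates_inter (hΓ : IsClosedSurfaceGroup Γ) (H : IsAxial Γ r M V h) {K : Set ℍ}
    (hK : IsCompact K) : {W | (∃ γ ∈ Γ, W = γ • V) ∧ (W ∩ K).Nonempty}.Finite := by
  refine (H.finite_translates hΓ r hK).subset ?_
  rintro _ ⟨⟨γ, hγ, rfl⟩, _, ⟨z, hz, rfl⟩, hzK⟩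
  exact ⟨γ, hγ, rfl, h⁻¹ • z, H.mem_cone z hz, by rwa [smul_inv_smul]⟩

/-- All but finitely many translates of an axial set are small in the disk. -/
lemma finite_translates_large (hΓ : IsClosedSurfaceGroup Γ) (H : IsAxial Γ r M V h) (hr : 0 ≤ r)
    {ε : ℝ} (hε : 0 < ε) : {W | (∃ γ ∈ Γ, W = γ • V) ∧
      ¬ ∀ z ∈ W, ∀ w ∈ W, ‖toDisk z - toDisk w‖ ≤ ε}.Finite := by
  -- With this cone parameter, an axis far from `I` has a neighbourhood of diameter at most `ε` by
  -- `norm_toDisk_smul_sub_le`.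
  refine (H.finite_translates hΓ (4 * (1 + r) ^ 2 / ε)
    (isCompact_singleton (x := UpperHalfPlane.I))).subset ?_
  rintro _ ⟨⟨γ, hγ, rfl⟩, hW⟩
  refine ⟨γ, hγ, rfl, (γ * h)⁻¹ • UpperHalfPlane.I, ?_, ?_⟩
  · by_contra hI
    apply hW
    intro z hz w hw
    have hlt := not_le.1 (fun hle => hI ((inv_smul_I_mem_cone_iff _ _).2 hle))
    have h1 := norm_toDisk_smul_sub_le hr (γ * h) ((H.smul hγ).mem_cone z hz)
      ((H.smul hγ).mem_cone w hw)
    rw [smul_inv_smul, smul_inv_smul] at h1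
    refine h1.trans ?_
    have hC : 0 < ‖diskC (γ * h)‖ := norm_pos_iff.2 (diskC_ne_zero _)
    have hD : 0 < ‖diskD (γ * h)‖ := norm_pos_iff.2 (diskD_ne_zero _)
    rw [div_lt_iff₀ hε] at hlt
    rw [div_le_iff₀ (by positivity)]
    linarith
  · rw [← mul_smul γ h, smul_inv_smul]
    rfl

/-- The end of an axial set can be moved to `∞`. -/
lemma exists_end_eq (H : IsAxial Γ r M V h) (hr : 0 < r) {ξ : ℂ} (hξ : ‖ξ‖ = 1)
    (hcl : ξ ∈ closure (toDisk '' V)) :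
    ∃ h', IsAxial Γ r M V h' ∧ ξ = conj (diskC h') / diskC h' := by
  have hsub : toDisk '' V ⊆ (fun z : ℍ => toDisk (h • z)) '' cone r := by
    rintro _ ⟨z, hz, rfl⟩
    exact ⟨h⁻¹ • z, H.mem_cone z hz, by simp⟩
  rcases eq_or_eq_of_mem_closure_cone hr h hξ (closure_mono hsub hcl) with h1 | h1
  · exact ⟨h, H, h1⟩
  · exact ⟨h * FLOiation.halfTurn, H.halfTurn, by rw [diskC_mul_halfTurn, h1]⟩

end IsAxial

/-- Equal images of `∞` mean that `h⁻¹ * h'` fixes `∞`, so it acts as an affine map `z ↦ u z + v`.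
-/
lemma inv_mul_apply_one_zero_of_end_eq {h h' : SL(2, ℝ)}
    (he : conj (diskC h) / diskC h = conj (diskC h') / diskC h') : (h⁻¹ * h') 1 0 = 0 := by
  rw [div_eq_div_iff (diskC_ne_zero h) (diskC_ne_zero h')] at he
  have h1 := congrArg Complex.im he
  have e10 : h⁻¹ 1 0 = - h 1 0 := by simp [Matrix.SpecialLinearGroup.SL2_inv_expl]
  have e11 : h⁻¹ 1 1 = h 0 0 := by simp [Matrix.SpecialLinearGroup.SL2_inv_expl]
  rw [mul_apply_two, e10, e11]
  simp [diskC] at h1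
  linarith

/-- An axial set with the same end as the axis of `h₀` comes close to all points of that axis which
are close to the end. -/
lemma IsAxial.exists_inter_slab {Γ : Subgroup SL(2, ℝ)} {r M : ℝ} {V : Set ℍ} {h h₀ g₀ : SL(2, ℝ)}
    (H : IsAxial Γ r M V h) (he : conj (diskC h₀) / diskC h₀ = conj (diskC h) / diskC h)
    {μ₀ : {x : ℝ // 0 < x}} (hμ₀ : 1 < μ₀) (H₀ : IsTranslation g₀ h₀ μ₀) :
    ∃ n₀ : ℕ, ∀ n ≥ n₀,
      ((g₀ ^ n)⁻¹ • V ∩ (fun z : ℍ => h₀ • z) '' slab (r + 1) 1 M).Nonempty := by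
  obtain ⟨u, v, huv⟩ := exists_SL2_smul_eq_of_apply_zero_one_eq_zero _
    (inv_mul_apply_one_zero_of_end_eq he)
  have huv : ∀ z : ℍ, h • z = h₀ • (v +ᵥ u • z) := fun z => by
    have := congrFun huv z
    simp only [Function.comp_apply, mul_smul, inv_smul_eq_iff] at this
    exact this
  have hμ₀' : (1 : ℝ) < μ₀ := hμ₀
  obtain ⟨n₀, hn₀⟩ := pow_unbounded_of_one_lt |v| hμ₀'
  refine ⟨n₀, fun n hn => ?_⟩
  have hvn : |v| ≤ (μ₀ : ℝ) ^ n := hn₀.le.trans (pow_le_pow_right₀ hμ₀'.le hn)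
  obtain ⟨g, hg, μ, h1, h2, h3, h4⟩ := H.translation
  have hμ : (1 : ℝ) < μ := h1
  obtain ⟨p, hp⟩ := H.nonempty
  set w := h⁻¹ • p with hw
  have hwc : w ∈ cone r := H.mem_cone p hp
  have hX : 0 < (μ₀ : ℝ) ^ n := pow_pos μ₀.2 n
  have hy : 0 < (u : ℝ) * w.im := mul_pos u.2 w.im_pos
  -- With `k = j + 1` the point reaches a height between `μ₀ ^ n` and `μ * μ₀ ^ n`. The shift `v` is
  -- then at most the height, which costs `1` in the cone parameter.
  obtain ⟨j, hj1, hj2⟩ := exists_mem_Ico_zpow (div_pos hX hy) hμ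
  rw [le_div_iff₀ hy] at hj1
  rw [div_lt_iff₀ hy] at hj2
  set k := j + 1
  have hmem : h₀ • (v +ᵥ u • μ ^ k • w) ∈ V := by
    rw [← huv, ← h3.zpow k, hw, smul_inv_smul, ← IsAxial.zpow_smul_eq h4 k]
    exact Set.smul_mem_smul_set hp
  have him : (v +ᵥ u • μ ^ k • w).im = (μ : ℝ) ^ k * (u * w.im) := by
    rw [vadd_im, pos_real_im, pos_real_im, Positive.coe_zpow]
    ring
  have hcone : v +ᵥ u • μ ^ k • w ∈ cone (r + 1) := by
    have h5 : u • μ ^ k • w ∈ cone r := by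
      rw [smul_mem_cone_iff, smul_mem_cone_iff]
      exact hwc
    have h5 : ‖((u • μ ^ k • w : ℍ) : ℂ)‖ ≤ r * (v +ᵥ u • μ ^ k • w).im := by
      rw [vadd_im]
      exact h5
    change ‖((v +ᵥ u • μ ^ k • w : ℍ) : ℂ)‖ ≤ (r + 1) * (v +ᵥ u • μ ^ k • w).im
    rw [coe_vadd]
    refine (norm_add_le _ _).trans ?_
    have h6 : ‖(v : ℂ)‖ ≤ (v +ᵥ u • μ ^ k • w).im := by
      rw [Complex.norm_real, him]
      exact hvn.trans hj2.le
    linarith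
  refine ⟨h₀ • (μ₀ ^ n)⁻¹ • (v +ᵥ u • μ ^ k • w), ?_, _,
    ⟨(smul_mem_cone_iff _).2 hcone, ?_, ?_⟩, rfl⟩
  · rw [← (H₀.pow n).inv]
    exact Set.smul_mem_smul_set hmem
  · rw [pos_real_im, him, Positive.coe_inv, Positive.val_pow, inv_mul_eq_div, le_div_iff₀ hX]
    linarith
  · rw [pos_real_im, him, Positive.coe_inv, Positive.val_pow, inv_mul_eq_div, div_le_iff₀ hX]
    have : (μ : ℝ) ^ k = μ ^ j * μ := zpow_add_one₀ μ.2.ne' j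
    calc (μ : ℝ) ^ k * (u * w.im) = μ * (μ ^ j * (u * w.im)) := by rw [this]; ring
      _ ≤ M * (μ₀ : ℝ) ^ n := by
        gcongr
        · linarith

/-- In a locally finite invariant family of axial sets only finitely many have a given end. -/
lemma finite_common_end {Γ : Subgroup SL(2, ℝ)} {r M : ℝ} (hr : 0 < r) {F : Set (Set ℍ)}
    (hinv : ∀ V ∈ F, ∀ γ ∈ Γ, γ • V ∈ F) (hax : ∀ V ∈ F, ∃ h, IsAxial Γ r M V h)
    (hlf : ∀ K : Set ℍ, IsCompact K → {V ∈ F | (V ∩ K).Nonempty}.Finite) {ξ : ℂ} (hξ : ‖ξ‖ = 1) :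
    {V ∈ F | ξ ∈ closure (toDisk '' V)}.Finite := by
  rcases {V ∈ F | ξ ∈ closure (toDisk '' V)}.eq_empty_or_nonempty with h0 | ⟨V₀, hV₀, hξ₀⟩
  · rw [h0]
    exact Set.finite_empty
  obtain ⟨h₀', H₀'⟩ := hax V₀ hV₀
  obtain ⟨h₀, H₀, he₀⟩ := H₀'.exists_end_eq hr hξ hξ₀
  obtain ⟨g₀, hg₀, μ₀, hμ₀, -, Ht, -⟩ := H₀.translation
  have hc : IsCompact ((fun z : ℍ => h₀ • z) '' slab (r + 1) 1 M) :=
    (isCompact_slab _ _ zero_lt_one).image (continuous_const_smul h₀)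
  have hfin := hlf _ hc
  refine hfin.subset ?_
  rintro V ⟨hV, hξV⟩
  obtain ⟨h', H'⟩ := hax V hV
  obtain ⟨h, H, he⟩ := H'.exists_end_eq hr hξ hξV
  obtain ⟨n₀, hn₀⟩ := H.exists_inter_slab (he₀.symm.trans he) hμ₀ Ht
  have hmem : ∀ n : ℕ, (g₀ ^ (n₀ + n))⁻¹ • V ∈
      {V ∈ F | (V ∩ (fun z : ℍ => h₀ • z) '' slab (r + 1) 1 M).Nonempty} := fun n =>
    ⟨hinv V hV _ (Γ.inv_mem (Γ.pow_mem hg₀ _)), hn₀ _ (Nat.le_add_right _ _)⟩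
  -- Pigeonhole: two of the pulled-back sets coincide, so a positive power of `g₀` preserves `V`.
  obtain ⟨i, j, hij, heq⟩ := hfin.exists_lt_map_eq_of_forall_mem hmem
  obtain ⟨d, rfl⟩ := Nat.exists_eq_add_of_lt hij
  have hstab : g₀ ^ (d + 1) ∈ MulAction.stabilizer SL(2, ℝ) V := by
    rw [MulAction.mem_stabilizer_iff]
    rw [show n₀ + (i + d + 1) = (d + 1) + (n₀ + i) by ring, pow_add g₀ (d + 1), mul_inv_rev,
      mul_smul, smul_left_cancel_iff, eq_inv_smul_iff] at heq
    exact heq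
  -- The `n₀`-th power makes the exponent at least `n₀`, so the pullback, which is `V` itself, meets
  -- the slab.
  have h5 := Subgroup.inv_mem _ (Subgroup.pow_mem _ hstab n₀)
  rw [← pow_mul, MulAction.mem_stabilizer_iff] at h5
  have h6 := hn₀ ((d + 1) * n₀) (Nat.le_mul_of_pos_left _ (Nat.succ_pos d))
  rw [h5] at h6
  exact ⟨hV, h6⟩

/-! ### The family of walls -/

/-- The walls belong to a locally finite invariant family of uniformly axial sets, which are
eventually small in the disk. -/
lemma exists_wall_family {Γ : Subgroup SL(2, ℝ)} (hΓ : IsClosedSurfaceGroup Γ)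
    (Δ : OneVertexTriangulation (Surface Γ)) (hΔ : Δ.IsEssential) :
    ∃ (F : Set (Set ℍ)) (r M : ℝ), 0 < r ∧ (∀ W, IsWall Δ W → W ∈ F) ∧
      (∀ V ∈ F, ∀ γ ∈ Γ, γ • V ∈ F) ∧ (∀ V ∈ F, ∃ h, IsAxial Γ r M V h) ∧
      (∀ K : Set ℍ, IsCompact K → {V ∈ F | (V ∩ K).Nonempty}.Finite) ∧
      ∀ ε > 0, {V ∈ F | ¬ ∀ z ∈ V, ∀ w ∈ V, ‖toDisk z - toDisk w‖ ≤ ε}.Finite := by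
  have key : ∀ a : Δ.Edge, ∃ (Y : Set ℍ) (h : SL(2, ℝ)) (r M : ℝ), IsAxial Γ r M Y h ∧
      ∀ z ∈ proj Γ ⁻¹' Set.range (Δ.edge a), ∃ γ ∈ Γ,
        connectedComponentIn (proj Γ ⁻¹' Set.range (Δ.edge a)) z = γ • Y := by
    intro a
    obtain ⟨K, g, hK, hne, hg, H⟩ := exists_wall_structure hΓ Δ hΔ a
    obtain ⟨h, μ, hμ, Ht⟩ := hΓ.exists_isTranslation g.2 hg
    obtain ⟨r, hr⟩ := hK.exists_bound_of_continuousOn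
      (f := fun z : ℍ => ((h⁻¹ • z : ℍ) : ℂ) / ((h⁻¹ • z).im : ℂ)) (by
        apply Continuous.continuousOn
        have h1 : Continuous fun z : ℍ => h⁻¹ • z := continuous_const_smul _
        refine (continuous_coe.comp h1).div (Complex.continuous_ofReal.comp (continuous_im.comp h1))
          fun z => ?_
        exact_mod_cast (h⁻¹ • z).im_pos.ne')
    refine ⟨⋃ n : ℤ, g ^ n • K, h, r, μ, ⟨?_, ⟨g, g.2, μ, hμ, le_rfl, Ht, ?_⟩, ?_⟩, ?_⟩
    · exact Set.nonempty_iUnion.2 ⟨0, hne.smul_set⟩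
    · change g • ⋃ n : ℤ, g ^ n • K = _
      rw [Set.smul_set_iUnion]
      simp only [← mul_smul, ← zpow_one_add]
      exact (Equiv.addLeft (1 : ℤ)).surjective.iUnion_comp (fun n : ℤ => g ^ n • K)
    · intro z hz
      obtain ⟨n, k, hk, rfl⟩ := Set.mem_iUnion.1 hz
      have e : h⁻¹ • (g ^ n) • k = μ ^ n • h⁻¹ • k := by
        rw [inv_smul_eq_iff, ← Ht.zpow n, smul_inv_smul]
        rfl
      change h⁻¹ • (g ^ n) • k ∈ cone r
      rw [e, smul_mem_cone_iff]
      have := hr k hk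
      have him := (h⁻¹ • k).im_pos
      rw [norm_div, Complex.norm_real, Real.norm_of_nonneg him.le, div_le_iff₀ him] at this
      exact this
    · intro z hz
      obtain ⟨γ, hγ⟩ := H z hz
      exact ⟨γ, γ.2, hγ⟩
  choose Y h r M hax hwall using key
  have := Δ.finite_edge
  obtain ⟨r', hr'⟩ := (Set.finite_range r).bddAbove
  obtain ⟨M', hM'⟩ := (Set.finite_range M).bddAbove
  have hax' : ∀ a, IsAxial Γ (max r' 1) M' (Y a) (h a) := fun a =>
    (hax a).mono ((hr' ⟨a, rfl⟩).trans (le_max_left _ _)) (hM' ⟨a, rfl⟩)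
  -- All translates of the finitely many models are taken, which makes invariance immediate.
  refine ⟨⋃ a, {W | ∃ γ ∈ Γ, W = γ • Y a}, max r' 1, M', by positivity, ?_, ?_, ?_, ?_, ?_⟩
  · rintro W ⟨a, z, hz, rfl⟩
    exact Set.mem_iUnion.2 ⟨a, hwall a z hz⟩
  · intro V hV γ hγ
    obtain ⟨a, γ', hγ', rfl⟩ := Set.mem_iUnion.1 hV
    exact Set.mem_iUnion.2 ⟨a, γ * γ', Γ.mul_mem hγ hγ', by rw [mul_smul]⟩
  · intro V hV
    obtain ⟨a, γ', hγ', rfl⟩ := Set.mem_iUnion.1 hV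
    exact ⟨_, (hax' a).smul hγ'⟩
  · intro K hK
    refine (Set.finite_iUnion fun a => (hax' a).finite_translates_inter hΓ hK).subset ?_
    rintro V ⟨hV, hVK⟩
    obtain ⟨a, ha⟩ := Set.mem_iUnion.1 hV
    exact Set.mem_iUnion.2 ⟨a, ha, hVK⟩
  · intro ε hε
    refine (Set.finite_iUnion fun a =>
      (hax' a).finite_translates_large hΓ (by positivity) hε).subset ?_
    rintro V ⟨hV, hVK⟩
    obtain ⟨a, ha⟩ := Set.mem_iUnion.1 hV
    exact Set.mem_iUnion.2 ⟨a, ha, hVK⟩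

/-! ### Separation by walls -/

/-- The points `x` and `y` lie in different half-spaces of `W`. -/
def Separates (W : Set ℍ) (x y : ℍ) : Prop :=
  x ∈ Wᶜ ∧ y ∈ Wᶜ ∧ connectedComponentIn Wᶜ x ≠ connectedComponentIn Wᶜ y

lemma Separates.symm {W : Set ℍ} {x y : ℍ} (h : Separates W x y) : Separates W y x :=
  ⟨h.2.1, h.1, h.2.2.symm⟩

lemma Separates.inter_nonempty {W : Set ℍ} {x y : ℍ} (h : Separates W x y) {C : Set ℍ}
    (hC : IsPreconnected C) (hx : x ∈ C) (hy : y ∈ C) : (W ∩ C).Nonempty := by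
  by_contra hne
  have hsub : C ⊆ Wᶜ := fun z hz hW => hne ⟨z, hW, hz⟩
  exact h.2.2 (connectedComponentIn_eq (hC.subset_connectedComponentIn hx hsub hy))

/-- Transversality is local at `t`, but the path misses `W` at all other times, so its parts before
and after `t` each stay in one half-space. -/
lemma separates_of_isTransverseAt {T : Type} [ConditionallyCompleteLinearOrder T]
    [TopologicalSpace T] [OrderTopology T] [DenselyOrdered T] {L : T → ℍ} (hL : Continuous L)
    {W : Set ℍ} {t : T} (hsub : {t | L t ∈ W}.Subsingleton) (ht : L t ∈ W)
    (htr : IsTransverseAt L W t) {s u : T} (hs : s < t) (hu : t < u) :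
    Separates W (L s) (L u) := by
  obtain ⟨H₁, H₂, ⟨z₁, hz₁, rfl⟩, ⟨z₂, hz₂, rfl⟩, hne, h₁, h₂⟩ := htr
  have hmiss : ∀ v, v ≠ t → L v ∈ Wᶜ := fun v hv hW => hv (hsub hW ht)
  have := nhdsLT_neBot_of_exists_lt ⟨s, hs⟩
  have := nhdsGT_neBot_of_exists_gt ⟨u, hu⟩
  obtain ⟨v₁, hv₁, hv₁t⟩ := (h₁.and self_mem_nhdsWithin).exists
  obtain ⟨v₂, hv₂, hv₂t⟩ := (h₂.and self_mem_nhdsWithin).exists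
  have e₁ : connectedComponentIn Wᶜ (L v₁) = connectedComponentIn Wᶜ (L s) := by
    apply connectedComponentIn_eq
    refine (isPreconnected_Iio.image L hL.continuousOn).subset_connectedComponentIn
      (Set.mem_image_of_mem L hv₁t) ?_ (Set.mem_image_of_mem L hs)
    rintro _ ⟨v, hv, rfl⟩
    exact hmiss v (ne_of_lt hv)
  have e₂ : connectedComponentIn Wᶜ (L v₂) = connectedComponentIn Wᶜ (L u) := by
    apply connectedComponentIn_eq
    refine (isPreconnected_Ioi.image L hL.continuousOn).subset_connectedComponentIn
      (Set.mem_image_of_mem L hv₂t) ?_ (Set.mem_image_of_mem L hu)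
    rintro _ ⟨v, hv, rfl⟩
    exact hmiss v (ne_of_gt hv)
  refine ⟨hmiss s hs.ne, hmiss u hu.ne', ?_⟩
  rw [← e₁, ← e₂, ← connectedComponentIn_eq hv₁, ← connectedComponentIn_eq hv₂]
  exact hne

/-! ### Endpoints -/

lemma re_mul_conj_le_norm (x : ℂ) {e : ℂ} (he : ‖e‖ = 1) : (x * conj e).re ≤ ‖x‖ := by
  refine (Complex.re_le_norm _).trans ?_
  simp [he]

/-- All but finitely many members of a locally finite family of sets which are eventually small in
the disk lie in small caps of the disk. -/
lemma finite_not_in_cap {F : Set (Set ℍ)} (hne : ∀ V ∈ F, V.Nonempty)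
    (hlf : ∀ K : Set ℍ, IsCompact K → {V ∈ F | (V ∩ K).Nonempty}.Finite)
    (hsmall : ∀ ε > 0, {V ∈ F | ¬ ∀ z ∈ V, ∀ w ∈ V, ‖toDisk z - toDisk w‖ ≤ ε}.Finite)
    {s : ℝ} (hs0 : 0 ≤ s) (hs : s < 1) :
    {V ∈ F | ¬ ∃ e : ℂ, ‖e‖ = 1 ∧ ∀ z ∈ V, s < (toDisk z * conj e).re}.Finite := by
  -- A set with a point of norm above `(1 + s) / 2` and diameter at most `(1 - s) / 2` stays beyond
  -- `s` in the direction of that point.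
  refine ((hlf _ (isCompact_toDisk_preimage_closedBall (s := (1 + s) / 2) (by linarith))).union
    (hsmall ((1 - s) / 2) (by linarith))).subset ?_
  rintro V ⟨hV, hcap⟩
  by_contra hcon
  simp only [Set.mem_union, Set.mem_ofPred_eq, not_or, not_not, hV, true_and] at hcon
  obtain ⟨hcon1, hcon2⟩ := hcon
  apply hcap
  obtain ⟨p, hp⟩ := hne V hV
  have hpn : (1 + s) / 2 < ‖toDisk p‖ := by
    by_contra! hle
    exact hcon1 ⟨p, hp, by simpa using hle⟩
  have hp0 : 0 < ‖toDisk p‖ := by linarith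
  have hp0' : (‖toDisk p‖ : ℂ) ≠ 0 := by exact_mod_cast hp0.ne'
  have he : ‖toDisk p / ‖toDisk p‖‖ = 1 := by
    rw [norm_div, Complex.norm_real, norm_norm, div_self hp0.ne']
  refine ⟨toDisk p / ‖toDisk p‖, he, fun z hz => ?_⟩
  have h1 := hcon2 p hp z hz
  have h2 := re_mul_conj_le_norm (toDisk p - toDisk z) he
  have h3 : (toDisk p * conj (toDisk p / ‖toDisk p‖)).re = ‖toDisk p‖ := by
    rw [map_div₀, Complex.conj_ofReal, mul_div_assoc', Complex.mul_conj, Complex.normSq_eq_norm_sq]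
    have : ((‖toDisk p‖ ^ 2 : ℝ) : ℂ) / ‖toDisk p‖ = ((‖toDisk p‖ : ℝ) : ℂ) := by
      push_cast
      field_simp
    rw [this, Complex.ofReal_re]
  rw [sub_mul, Complex.sub_re, h3] at h2
  linarith

/-- A ray crossing infinitely many members of such a family converges in the disk. -/
lemma exists_hasEndpoint {F : Set (Set ℍ)} (hne : ∀ V ∈ F, V.Nonempty)
    (hlf : ∀ K : Set ℍ, IsCompact K → {V ∈ F | (V ∩ K).Nonempty}.Finite)
    (hsmall : ∀ ε > 0, {V ∈ F | ¬ ∀ z ∈ V, ∀ w ∈ V, ‖toDisk z - toDisk w‖ ≤ ε}.Finite)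
    {L : ℝ≥0 → ℍ}
    (hcross : {V ∈ F | ∃ t, L t ∈ V ∧ ∀ s < t, ∀ u > t, Separates V (L s) (L u)}.Infinite) :
    ∃ ξ : Circle, HasEndpoint L ξ := by
  have hcap : ∀ s : ℝ, ‖toDisk (L 0)‖ ≤ s → s < 1 → ∃ (e : ℂ) (t : ℝ≥0), ‖e‖ = 1 ∧
      ∀ u > t, s < (toDisk (L u) * conj e).re := by
    intro s hs0 hs1
    have hfin := (hlf _ (isCompact_singleton (x := L 0))).union
      (finite_not_in_cap hne hlf hsmall ((norm_nonneg _).trans hs0) hs1)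
    obtain ⟨V, ⟨hV, t, htV, hsep⟩, hVn⟩ := (hcross.sdiff hfin).nonempty
    simp only [Set.mem_union, Set.mem_ofPred_eq, not_or, not_not, hV, true_and] at hVn
    obtain ⟨hV0, e, he, hVe⟩ := hVn
    have ht0 : 0 < t := by
      refine pos_iff_ne_zero.2 fun h0 => hV0 ?_
      rw [h0] at htV
      exact ⟨L 0, htV, rfl⟩
    refine ⟨e, t, he, fun u hu => ?_⟩
    by_contra! hle
    -- The complement of the cap is convex and contains `L 0`; if it also contained `L u`, the wall
    -- would have to meet it.
    have hconv : Convex ℝ {w : ℂ | (w * conj e).re ≤ s} :=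
      convex_halfSpace_le (f := fun w : ℂ => (w * conj e).re)
        ⟨fun x y => by simp only [add_mul, Complex.add_re],
          fun c x => by rw [smul_mul_assoc, Complex.smul_re]⟩ s
    obtain ⟨z, hzV, hzC⟩ := (hsep 0 ht0 u hu).inter_nonempty (isPreconnected_preimage_toDisk hconv)
      ((re_mul_conj_le_norm _ he).trans hs0) hle
    exact absurd hzC (not_le.2 (hVe z hzV))
  have hlim : ∀ ε > 0, ∃ (e : ℂ) (t : ℝ≥0), ‖e‖ = 1 ∧ ∀ u > t, ‖toDisk (L u) - e‖ < ε := by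
    intro ε hε
    -- For `‖x‖ < 1` and `Re (x * conj e) > 1 - ε ^ 2 / 4` one gets `‖x - e‖ ^ 2 < ε ^ 2 / 2`.
    obtain ⟨e, t, he, H⟩ := hcap (max ‖toDisk (L 0)‖ (1 - ε ^ 2 / 4)) (le_max_left _ _)
      (max_lt (norm_toDisk_lt_one _) (by linarith [sq_pos_of_pos hε]))
    refine ⟨e, t, he, fun u hu => ?_⟩
    have h1 := (le_max_right _ _).trans_lt (H u hu)
    have h2 := norm_toDisk_lt_one (L u)
    have h3 : ‖toDisk (L u) - e‖ ^ 2 = ‖toDisk (L u)‖ ^ 2 + ‖e‖ ^ 2 -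
        2 * (toDisk (L u) * conj e).re := by
      rw [← Complex.normSq_eq_norm_sq, ← Complex.normSq_eq_norm_sq, ← Complex.normSq_eq_norm_sq,
        Complex.normSq_sub]
    rw [he] at h3
    have h4 : ‖toDisk (L u)‖ ^ 2 < 1 := by nlinarith [norm_nonneg (toDisk (L u))]
    have h5 : ‖toDisk (L u) - e‖ ^ 2 < ε ^ 2 := by nlinarith
    exact lt_of_pow_lt_pow_left₀ 2 hε.le h5
  have hcauchy : CauchySeq (fun t => toDisk (L t)) := by
    rw [Metric.cauchySeq_iff]
    intro ε hε
    obtain ⟨e, t, he, H⟩ := hlim (ε / 2) (by linarith)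
    refine ⟨t + 1, fun m hm n hn => ?_⟩
    have hm := H m (lt_of_lt_of_le (lt_add_one t) hm)
    have hn := H n (lt_of_lt_of_le (lt_add_one t) hn)
    rw [← dist_eq_norm] at hm hn
    linarith [dist_triangle_right (toDisk (L m)) (toDisk (L n)) e]
  obtain ⟨ξ, hξ⟩ := cauchySeq_tendsto_of_complete hcauchy
  have hnorm : ‖ξ‖ = 1 := by
    refine eq_of_forall_dist_le fun ε hε => ?_
    obtain ⟨e, t, he, H⟩ := hlim ε hε
    refine le_of_tendsto (hξ.norm.dist tendsto_const_nhds) ?_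
    filter_upwards [eventually_gt_atTop t] with u hu
    rw [Real.dist_eq, ← he]
    exact (abs_norm_sub_norm_le _ _).trans (H u hu).le
  exact ⟨⟨ξ, by simpa [Submonoid.unitSphere] using hnorm⟩, hξ⟩

lemma HasEndpoint.unique {L : ℝ≥0 → ℍ} {ξ η : Circle} (h₁ : HasEndpoint L ξ)
    (h₂ : HasEndpoint L η) : ξ = η :=
  Circle.ext (tendsto_nhds_unique h₁ h₂)

/-- A set which separates two sequences converging to `ξ` accumulates at `ξ`. -/
lemma mem_closure_of_separates {L : ℝ → ℍ} {ξ : ℂ} {V : Set ℍ} {t : ℝ}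
    (h₁ : Tendsto (fun t : ℝ≥0 => toDisk (L t)) atTop (𝓝 ξ))
    (h₂ : Tendsto (fun t : ℝ≥0 => toDisk (L (-t))) atTop (𝓝 ξ))
    (hsep : ∀ s < t, ∀ u > t, Separates V (L s) (L u)) : ξ ∈ closure (toDisk '' V) := by
  rw [Metric.mem_closure_iff]
  intro ε hε
  have hb : ∀ᶠ x : ℝ≥0 in atTop, |t| < x := by
    filter_upwards [eventually_gt_atTop (Real.toNNReal |t|)] with x hx
    exact (Real.toNNReal_lt_iff_lt_coe (abs_nonneg t)).1 hx
  obtain ⟨x, ⟨hx1, hx2⟩, hx3⟩ := (((h₁.eventually (Metric.ball_mem_nhds ξ hε)).and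
    (h₂.eventually (Metric.ball_mem_nhds ξ hε))).and hb).exists
  have hlt := abs_lt.1 hx3
  obtain ⟨z, hzV, hz⟩ := (hsep (-x) (by linarith) x hlt.2).inter_nonempty
    (isPreconnected_preimage_toDisk (convex_ball ξ ε)) hx2 hx1
  exact ⟨_, ⟨z, hzV, rfl⟩, by rw [dist_comm]; exact hz⟩

end FLOiation

/-! ### Endpoints of paths transverse to the walls -/

theorem mainTheorem3 (Γ : Subgroup SL(2, ℝ)) (hΓ : FLOiation.IsClosedSurfaceGroup Γ)
    (Δ : FLOiation.OneVertexTriangulation (FLOiation.Surface Γ)) (hΔ : Δ.IsEssential) :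
    (∀ L : ℝ≥0 → ℍ, IsEmbedding L → FLOiation.MeetsWallsTransversely Δ L →
      FLOiation.MeetsInfinitelyManyWalls Δ L → ∃! ξ : Circle, FLOiation.HasEndpoint L ξ) ∧
    (∀ L : ℝ → ℍ, Continuous L → FLOiation.MeetsWallsTransversely Δ L →
      FLOiation.MeetsInfinitelyManyWalls Δ (fun t : ℝ≥0 => L t) →
      FLOiation.MeetsInfinitelyManyWalls Δ (fun t : ℝ≥0 => L (-t)) →
      ∃ ξ₁ ξ₂ : Circle, FLOiation.HasEndpoint (fun t : ℝ≥0 => L t) ξ₁ ∧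
        FLOiation.HasEndpoint (fun t : ℝ≥0 => L (-t)) ξ₂ ∧ ξ₁ ≠ ξ₂) := by
  obtain ⟨F, r, M, hr, hwall, hinv, hax, hlf, hsmall⟩ := FLOiation.exists_wall_family hΓ Δ hΔ
  have hne : ∀ V ∈ F, V.Nonempty := fun V hV => by
    obtain ⟨h, H⟩ := hax V hV
    exact H.nonempty
  constructor
  · intro L hL hT hinf
    obtain ⟨ξ, hξ⟩ := FLOiation.exists_hasEndpoint hne hlf hsmall (L := L) (hinf.mono (by
      rintro W ⟨hW, t, ht⟩
      exact ⟨hwall W hW, t, ht, fun s hs u hu => FLOiation.separates_of_isTransverseAt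
        hL.continuous (hT W hW).1 ht ((hT W hW).2 t ht) hs hu⟩))
    exact ⟨ξ, hξ, fun η hη => hη.unique hξ⟩
  · intro L hL hT hinf₁ hinf₂
    have hsep : ∀ W, FLOiation.IsWall Δ W → ∀ t, L t ∈ W → ∀ s < t, ∀ u > t,
        FLOiation.Separates W (L s) (L u) := fun W hW t ht s hs u hu =>
      FLOiation.separates_of_isTransverseAt hL (hT W hW).1 ht ((hT W hW).2 t ht) hs hu
    obtain ⟨ξ₁, hξ₁⟩ := FLOiation.exists_hasEndpoint hne hlf hsmall (L := fun t : ℝ≥0 => L t)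
      (hinf₁.mono (by
        rintro W ⟨hW, t, ht⟩
        exact ⟨hwall W hW, t, ht, fun s hs u hu => hsep W hW t ht s
          (NNReal.coe_lt_coe.2 hs) u (NNReal.coe_lt_coe.2 hu)⟩))
    obtain ⟨ξ₂, hξ₂⟩ := FLOiation.exists_hasEndpoint hne hlf hsmall (L := fun t : ℝ≥0 => L (-t))
      (hinf₂.mono (by
        rintro W ⟨hW, t, ht⟩
        exact ⟨hwall W hW, t, ht, fun s hs u hu => (hsep W hW (-t) ht (-u)
          (neg_lt_neg (NNReal.coe_lt_coe.2 hu)) (-s) (neg_lt_neg (NNReal.coe_lt_coe.2 hs))).symm⟩))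
    refine ⟨ξ₁, ξ₂, hξ₁, hξ₂, ?_⟩
    rintro rfl
    -- With equal endpoints, all the walls met by the forward ray accumulate at `ξ₁`, so there are
    -- only finitely many.
    refine hinf₁ ((FLOiation.finite_common_end hr hinv hax hlf (ξ := ξ₁)
      (Circle.norm_coe ξ₁)).subset ?_)
    rintro W ⟨hW, t, ht⟩
    exact ⟨hwall W hW, FLOiation.mem_closure_of_separates hξ₁ hξ₂ (hsep W hW t ht)⟩
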